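/- Let $m\ge 2$ be an integer and $L>0$. There is a constant $C>0$, depending only on $m$ and $L$, such that the following holds. Let $f_0:[0,1]^m\to[0,1]$ belong to $\mathrm{SLH}(m,L)$, that is, $f_0$ is measurable, invariant under every permutation of its $m$ arguments, and $|f_0(x)-f_0(y)|\le L\max_{1\le i\le m}|x_i-y_i|$ for all $x,y\in[0,1]^m$. Let $n\ge1$ be an integer and let $0<\rho_n\le1$ satisfy $\rho_n\ge(\log n)^2n^{-2/(m+1)}$. *Model.* Let $X_1,\dots,X_n$ be independent and uniform on $[0,1]$. Define the true probability tensor $\bar\Theta\in\mathbb R^{n\times\cdots\times n}$ (order $m$) by $\bar\Theta_j=\rho_nf_0(X_{j_1},\dots,X_{j_m})$ if $j=(j_1,\dots,j_m)\in[n]^m$ has distinct entries, and $\bar\Theta_j=0$ otherwise. Let $H$ be the set of tuples $j\in[n]^m$ with $j_1<\dots<j_m$. Given $X$, the variables $(\mathbf A_j)_{j\in H}$ are independent, $\mathbf A_j\sim\mathrm{Bernoulli}(\bar\Theta_j)$; the adjacency tensor $\mathbf A$ is extended symmetrically to tuples with distinct entries and is $0$ at tuples with a repeated entry. *Estimator.*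 Put $k=\lceil(\rho_nn^m)^{1/(m+2)}\rceil$ and $n_0=\lfloor n/k\rfloor$. Let $(\hat z,\hat{\mathbf Q})$ be any function of $\mathbf A$ that minimizes $$\sum_{a\in[k]^m}\ \sum_{j\in H,\ (z(j_1),\dots,z(j_m))=a}(\mathbf A_j-\mathbf Q_a)^2$$ over all maps $z:[n]\to[k]$ with $|z^{-1}(a)|\ge n_0$ for every $a\in[k]$ and all symmetric tensors $\mathbf Q\in[0,1]^{k\times\cdots\times k}$ of order $m$. Let $\hat\Theta_j=\hat{\mathbf Q}_{\hat z(j_1),\dots,\hat z(j_m)}$ if $j$ has distinct entries, and $\hat\Theta_j=0$ otherwise. Then, with $\|\cdot\|_F$ the Frobenius norm and the expectation taken over $X$ and $\mathbf A$, $$\mathbb E\Big[\frac1{n^m}\|\hat\Theta-\bar\Theta\|_F^2\Big]\le C\Big\{\rho_n^{\frac{2m+2}{m+2}}\,n^{-\frac{2m}{m+2}}+\rho_n\,\frac{\log n}{n^{m-1}}\Big\}.$$ -/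

import Mathlib

noncomputable section

namespace Hypergraphon

open MeasureTheory ProbabilityTheory

open scoped unitInterval

/-! ### Simple Lipschitz hypergraphons -/

/-- The class `SLH(m, L)`: measurable symmetric functions `f : [0,1]^m → [0,1]` with
`|f x - f y| ≤ L * max_i |x_i - y_i|`.  The distance on `Fin m → [0,1]` is the maximum
distance over the coordinates. -/
structure IsSLH {m : ℕ} (L : ℝ) (f : (Fin m → I) → I) : Prop where
  measurable : Measurable f
  symmetric : ∀ (τ : Equiv.Perm (Fin m)) (x : Fin m → I), f (x ∘ τ) = f x
  lipschitz : ∀ x y : Fin m → I, |(f x : ℝ) - (f y : ℝ)| ≤ L * dist x y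

/-! ### Tensors and hypergraphs -/

/-- Real tensors of order `m` with all dimensions equal to `n`. -/
abbrev Tensor (m n : ℕ) : Type := (Fin m → Fin n) → ℝ

/-- The squared Frobenius norm. -/
def frobeniusSq {m n : ℕ} (T : Tensor m n) : ℝ := ∑ j, T j ^ 2

/-- The set `H` of strictly increasing index tuples `j_1 < ⋯ < j_m` in `[n]`; these are the
possible hyperedges of an `m`-uniform hypergraph on `[n]`. -/
abbrev Edge (m n : ℕ) : Type := {j : Fin m → Fin n // StrictMono j}

instance (m n : ℕ) : Fintype (Edge m n) := Fintype.ofFinite _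

/-- An `m`-uniform hypergraph on `[n]`: which of the possible hyperedges are present. -/
abbrev Hypergraph (m n : ℕ) : Type := Edge m n → Bool

open Classical in
/-- The adjacency tensor: `A_j = 1` if the set `{j_1, …, j_m}` is a hyperedge and `A_j = 0`
otherwise; it is symmetric and vanishes at tuples with a repeated vertex. -/
def adjacency {m n : ℕ} (G : Hypergraph m n) : Tensor m n := fun j =>
  if ∃ e : Edge m n, Set.range e.1 = Set.range j ∧ G e = true then 1 else 0

/-! ### The sampling model -/

/-- The random hypergraph given the latent positions `x`: the hyperedges are independent, and
`e` is present with probability `ρ * f (x_{e_1}, …, x_{e_m})`. -/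
def edgeLaw {m n : ℕ} (ρ : I) (f : (Fin m → I) → I) (x : Fin n → I) :
    Measure (Hypergraph m n) :=
  Measure.pi fun e : Edge m n => bernoulliMeasure true false (ρ * f (x ∘ e.1))

instance {m n : ℕ} (ρ : I) (f : (Fin m → I) → I) (x : Fin n → I) :
    IsProbabilityMeasure (edgeLaw ρ f x) := by
  unfold edgeLaw; infer_instance

theorem measurable_edgeLaw {m n : ℕ} (ρ : I) {f : (Fin m → I) → I} (hf : Measurable f) :
    Measurable (edgeLaw (n := n) ρ f) := by
  refine Measurable.measure_of_isPiSystem_of_isProbabilityMeasure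
    generateFrom_pi.symm isPiSystem_pi ?_
  rintro _ ⟨s, -, rfl⟩
  simp only [edgeLaw, Measure.pi_pi]
  refine Finset.measurable_prod _ fun e _ => ?_
  have h : Measurable fun x : Fin n → I => ρ * f (x ∘ e.1) :=
    (hf.comp (measurable_pi_lambda (fun x : Fin n → I => x ∘ e.1)
      fun i => measurable_pi_apply (e.1 i))).const_mul ρ
  simp only [bernoulliMeasure_def, Measure.add_apply, Measure.smul_apply]
  have h1 : Measurable fun x : Fin n → I => (unitInterval.toNNReal (ρ * f (x ∘ e.1))) :=
    unitInterval.toNNReal_continuous.measurable.comp h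
  have h2 : Measurable fun x : Fin n → I => (unitInterval.toNNReal (σ (ρ * f (x ∘ e.1)))) :=
    unitInterval.toNNReal_continuous.measurable.comp
      (unitInterval.continuous_symm.measurable.comp h)
  exact (h1.coe_nnreal_ennreal.mul_const _).add (h2.coe_nnreal_ennreal.mul_const _)

/-- The conditional law of the hypergraph given the latent positions, as a Markov kernel. -/
def edgeKernel {m : ℕ} (n : ℕ) (ρ : I) (f : (Fin m → I) → I) (hf : Measurable f) :
    Kernel (Fin n → I) (Hypergraph m n) :=
  ⟨edgeLaw ρ f, measurable_edgeLaw ρ hf⟩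

instance {m n : ℕ} (ρ : I) (f : (Fin m → I) → I) (hf : Measurable f) :
    IsMarkovKernel (edgeKernel n ρ f hf) :=
  ⟨fun x => inferInstanceAs (IsProbabilityMeasure (edgeLaw ρ f x))⟩

/-- The joint law of the latent positions `X_1, …, X_n` (independent, uniform on `[0,1]`) and of
the sampled hypergraph. -/
def sampleLaw {m : ℕ} (n : ℕ) (ρ : I) (f : (Fin m → I) → I) (hf : Measurable f) :
    Measure ((Fin n → I) × Hypergraph m n) :=
  (Measure.pi fun _ : Fin n => (volume : Measure I)).compProd (edgeKernel n ρ f hf)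

instance {m n : ℕ} (ρ : I) (f : (Fin m → I) → I) (hf : Measurable f) :
    IsProbabilityMeasure (sampleLaw n ρ f hf) := by
  unfold sampleLaw; infer_instance

open Classical in
/-- The true probability tensor: `ρ * f (x_{j_1}, …, x_{j_m})` at tuples of distinct vertices,
zero elsewhere. -/
def trueTensor {m n : ℕ} (ρ : I) (f : (Fin m → I) → I) (x : Fin n → I) : Tensor m n := fun j =>
  if Function.Injective j then (ρ : ℝ) * (f (x ∘ j) : ℝ) else 0

/-! ### The balanced-block least-squares estimator -/

/-- `Z_{n,k,n₀}`: the assignments of `n` vertices to `k` blocks, each of size at least `n₀`. -/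
def balancedAssignments (n k n₀ : ℕ) : Set (Fin n → Fin k) :=
  {z | ∀ a : Fin k, n₀ ≤ (z ⁻¹' {a}).ncard}

/-- The symmetric tensors of order `m` and dimension `k` with entries in `[0,1]`. -/
def blockTensors (m k : ℕ) : Set (Tensor m k) :=
  {Q | (∀ a, Q a ∈ Set.Icc (0 : ℝ) 1) ∧ ∀ (τ : Equiv.Perm (Fin m)) (a), Q (a ∘ τ) = Q a}

open Classical in
/-- The least-squares loss: the sum over `a ∈ [k]^m` and over increasing tuples `j` with
`z(j) = a` of `(A_j - Q_a)^2`. -/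
def loss {m n k : ℕ} (A : Tensor m n) (z : Fin n → Fin k) (Q : Tensor m k) : ℝ :=
  ∑ a : Fin m → Fin k, ∑ j : Fin m → Fin n with StrictMono j ∧ z ∘ j = a, (A j - Q a) ^ 2

/-- `(z, Q)` minimizes the least-squares loss over `Z_{n,k,n₀}` and the block tensors. -/
structure IsLeastSquares {m n k : ℕ} (n₀ : ℕ) (A : Tensor m n) (z : Fin n → Fin k)
    (Q : Tensor m k) : Prop where
  assignment_mem : z ∈ balancedAssignments n k n₀
  tensor_mem : Q ∈ blockTensors m k
  loss_le : ∀ z' ∈ balancedAssignments n k n₀, ∀ Q' ∈ blockTensors m k, loss A z Q ≤ loss A z' Q'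

open Classical in
/-- The tensor of the block model `(z, Q)`: `Q_{z(j)}` at tuples of distinct vertices, zero
elsewhere. -/
def blockModel {m n k : ℕ} (z : Fin n → Fin k) (Q : Tensor m k) : Tensor m n := fun j =>
  if Function.Injective j then Q (z ∘ j) else 0

/-- The least-squares minimizer exists as soon as balanced assignments do. -/
theorem exists_isLeastSquares {m n k : ℕ} {n₀ : ℕ} (A : Tensor m n)
    (h : (balancedAssignments n k n₀).Nonempty) :
    ∃ (z : Fin n → Fin k) (Q : Tensor m k), IsLeastSquares n₀ A z Q := by
  have hc : IsCompact (blockTensors m k) := by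
    have h1 : IsCompact (Set.univ.pi fun _ : Fin m → Fin k => Set.Icc (0 : ℝ) 1) :=
      isCompact_univ_pi fun _ => isCompact_Icc
    refine h1.of_isClosed_subset ?_ fun Q hQ a _ => hQ.1 a
    have h2 : IsClosed {Q : Tensor m k | ∀ a, Q a ∈ Set.Icc (0 : ℝ) 1} := by
      simp only [Set.ofPred_forall]
      exact isClosed_iInter fun a => isClosed_Icc.preimage (continuous_apply a)
    have h3 : IsClosed {Q : Tensor m k |
        ∀ (τ : Equiv.Perm (Fin m)) (a : Fin m → Fin k), Q (a ∘ τ) = Q a} := by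
      simp only [Set.ofPred_forall]
      exact isClosed_iInter fun τ => isClosed_iInter fun a =>
        isClosed_eq (continuous_apply (a ∘ τ)) (continuous_apply a)
    exact h2.inter h3
  have hne : (blockTensors m k).Nonempty := ⟨0, fun _ => by simp, fun _ _ => rfl⟩
  have hmin : ∀ z : Fin n → Fin k, ∃ Q ∈ blockTensors m k,
      ∀ Q' ∈ blockTensors m k, loss A z Q ≤ loss A z Q' := fun z =>
    hc.exists_isMinOn hne (f := loss A z) (by unfold loss; fun_prop)
  choose Q hQ hQmin using hmin
  obtain ⟨z, hz, hzmin⟩ := Set.exists_min_image (balancedAssignments n k n₀)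
    (fun z => loss A z (Q z)) (Set.toFinite _) h
  exact ⟨z, Q z, hz, hQ z, fun z' hz' Q' hQ' => (hzmin z' hz').trans (hQmin z' Q' hQ')⟩

end Hypergraphon

end

/-! Fix the latent positions. An assignment `z` partitions the hyperedges by their unordered pattern
of blocks, and the estimator is least squares over the `k ^ n` such partitions. Its fitted tensor is
compared with an oracle: blocks of consecutive order statistics, with one value of the true tensor
per block tuple. Unless the positions leave a gap, these blocks have width `O(1/k)`, so the
Lipschitz condition gives a squared error `O(ρ² / k²)` per entry (`exists_block_approximation`).

Write `P` for averaging over the cells of the selected partition, `ε` for the centred noise and `θ`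
for the truth. The basic inequality leaves three noise terms: the energy `‖Pε‖²`, the form `⟨Pθ - θ,
ε⟩` compensated by a fraction of `‖Pθ - θ‖²`, and a form with fixed coefficients, of mean zero. The
first two depend on the data through `z` alone, so bounding exponential moments for each `z` and
paying `log (k ^ n)` for the selection suffices. To keep the factor `ρ`, one needs exponential
moments of `S² / V`, where `S` is a cell sum and `V` is `ρ` times the cell size. Bernoulli sums have
sub-Gaussian tails with variance proxy `V` only as long as `|S| ≲ V`; after truncation there, a
mixture of exponential tilts bounds the moment by a constant per cell. The cost is `ρ (n log k + k ^
m)`.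

The truncation must be inactive outside a rare event, uniformly over `z`. Chernoff's bound on a cell
is `exp (-V)`, and the union over its blocks costs `log n` times their total size; as blocks have at
least `n₀` vertices, this works when `ρ n₀ ^ (m - 1)` dominates `log n`. With `n₀ ≍ n / k` and `k ^
(m + 2) ≍ ρ n ^ m` this reads `k³ ≳ n log n`, which is what the density assumption provides
(`le_resolution_cube`). The same choice of `k` equates the bias `ρ² / k²` and the variance `ρ k ^ m
/ n ^ m`, both of the order of the first term of the rate; `ρ n log k / n ^ m` gives the second. -/

noncomputable section

namespace Hypergraphon

open MeasureTheory ProbabilityTheory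

open scoped unitInterval

/-! ### Independent centred Bernoulli variables -/

section BernoulliNoise

variable {ι : Type*} [Fintype ι]

/-- The law of independent Bernoulli variables with parameters `p`. -/
def bernoulliLaw (p : ι → I) : Measure (ι → Bool) :=
  Measure.pi fun e => bernoulliMeasure true false (p e)

instance (p : ι → I) : IsProbabilityMeasure (bernoulliLaw p) := by
  unfold bernoulliLaw; infer_instance

/-- The centred Bernoulli variables. -/
def noise (p : ι → I) (G : ι → Bool) (e : ι) : ℝ := (if G e = true then 1 else 0) - p e

theorem integrable_bernoulliLaw (p : ι → I) (F : (ι → Bool) → ℝ) :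
    Integrable F (bernoulliLaw p) := Integrable.of_finite

theorem integral_bernoulliMeasure_bool (p : I) (g : Bool → ℝ) :
    ∫ b, g b ∂bernoulliMeasure true false p = p * g true + (1 - p) * g false := by
  rw [integral_fintype Integrable.of_finite]
  simp [bernoulliMeasure_real_apply]

theorem integral_noise (p : ι → I) (c : ι → ℝ) :
    ∫ G, ∑ e, c e * noise p G e ∂bernoulliLaw p = 0 := by
  rw [integral_finsetSum _ fun e _ => integrable_bernoulliLaw p _]
  refine Finset.sum_eq_zero fun e _ => ?_
  rw [integral_const_mul]
  have h : ∫ G, noise p G e ∂bernoulliLaw p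
      = ∫ b, ((if b = true then (1 : ℝ) else 0) - p e) ∂bernoulliMeasure true false (p e) := by
    have := integral_comp_eval (μ := fun e => bernoulliMeasure true false (p e)) (i := e)
      (f := fun b : Bool => (if b = true then (1 : ℝ) else 0) - p e)
      (measurable_of_finite _).aestronglyMeasurable
    exact this
  rw [h, integral_bernoulliMeasure_bool]
  simp
  right; ring

/-- For tilts at most 1, `exp c ≤ 1 + c + c²` makes the variance proxy `θ ≤ ρ`; Hoeffding's bound
would lose the factor `ρ`. -/
theorem bernoulli_mgf_le {θ ρ c : ℝ} (h0 : 0 ≤ θ) (h1 : θ ≤ ρ) (hc : |c| ≤ 1) :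
    θ * Real.exp (c * (1 - θ)) + (1 - θ) * Real.exp (c * (0 - θ)) ≤ Real.exp (ρ * c ^ 2) := by
  have h2 : Real.exp c ≤ 1 + c + c ^ 2 := by
    have := (abs_le.1 (Real.abs_exp_sub_one_sub_id_le hc)).2
    linarith
  have h3 : θ * Real.exp (c * (1 - θ)) + (1 - θ) * Real.exp (c * (0 - θ))
      = Real.exp (-(c * θ)) * (θ * (Real.exp c - 1) + 1) := by
    have : Real.exp (c * (1 - θ)) = Real.exp (-(c * θ)) * Real.exp c := by
      rw [← Real.exp_add]; ring_nf
    rw [this, show c * (0 - θ) = -(c * θ) by ring]; ring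
  rw [h3]
  have h4 : θ * (Real.exp c - 1) + 1 ≤ Real.exp (θ * (Real.exp c - 1)) := Real.add_one_le_exp _
  calc Real.exp (-(c * θ)) * (θ * (Real.exp c - 1) + 1)
      ≤ Real.exp (-(c * θ)) * Real.exp (θ * (Real.exp c - 1)) := by gcongr
    _ = Real.exp (-(c * θ) + θ * (Real.exp c - 1)) := by rw [Real.exp_add]
    _ ≤ _ := by
      apply Real.exp_le_exp.2
      nlinarith [sq_nonneg c, mul_le_mul_of_nonneg_left h2 h0]

theorem integral_exp_noise_le {p : ι → I} {ρ : ℝ} (hp : ∀ e, (p e : ℝ) ≤ ρ) (c : ι → ℝ)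
    (hc : ∀ e, |c e| ≤ 1) :
    ∫ G, Real.exp (∑ e, c e * noise p G e) ∂bernoulliLaw p ≤ Real.exp (ρ * ∑ e, c e ^ 2) := by
  simp_rw [Real.exp_sum, Finset.mul_sum, Real.exp_sum]
  unfold bernoulliLaw noise
  rw [integral_fintype_prod_eq_prod
    (f := fun e (b : Bool) => Real.exp (c e * ((if b = true then 1 else 0) - (p e : ℝ))))]
  refine Finset.prod_le_prod (fun e _ => integral_nonneg fun _ => (Real.exp_pos _).le) fun e _ => ?_
  rw [integral_bernoulliMeasure_bool]
  simpa using bernoulli_mgf_le (p e).2.1 (hp e) (hc e)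

theorem neg_le_noise {κ : Type*} {p : κ → I} {ρ : ℝ} (hp : ∀ e, (p e : ℝ) ≤ ρ)
    (G : κ → Bool) (e : κ) :
    -ρ ≤ noise p G e := by
  unfold noise
  have := hp e
  split_ifs <;> linarith

theorem abs_noise_le {κ : Type*} (p : κ → I) (G : κ → Bool) (e : κ) : |noise p G e| ≤ 1 := by
  unfold noise
  have h1 := (p e).2.1
  have h2 := (p e).2.2
  rw [abs_le]
  split_ifs <;> constructor <;> linarith

/-- Chernoff's bound at twice the variance proxy. -/
theorem measureReal_noise_sum_gt_le {p : ι → I} {ρ : ℝ} (hp : ∀ e, (p e : ℝ) ≤ ρ)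
    (F : Finset ι) :
    (bernoulliLaw p).real {G | 2 * (ρ * F.card) < ∑ e ∈ F, noise p G e}
      ≤ Real.exp (-(ρ * F.card)) := by
  classical
  have h1 := integral_exp_noise_le hp (fun e => if e ∈ F then 1 else 0)
    (fun e => by split_ifs <;> simp)
  have h2 : ∑ e, (if e ∈ F then (1 : ℝ) else 0) ^ 2 = F.card := by simp
  rw [h2] at h1
  have h3 := mul_meas_ge_le_integral_of_nonneg (μ := bernoulliLaw p)
    (f := fun G => Real.exp (∑ e, (if e ∈ F then (1 : ℝ) else 0) * noise p G e))
    (Filter.Eventually.of_forall fun G => (Real.exp_pos _).le) (integrable_bernoulliLaw p _)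
    (Real.exp (2 * (ρ * F.card)))
  have h4 : (bernoulliLaw p).real {G | 2 * (ρ * F.card) < ∑ e ∈ F, noise p G e} ≤
      (bernoulliLaw p).real {G | Real.exp (2 * (ρ * F.card)) ≤
        Real.exp (∑ e, (if e ∈ F then (1 : ℝ) else 0) * noise p G e)} := by
    refine measureReal_mono ?_ (measure_ne_top _ _)
    intro G hG
    simp only [Set.mem_ofPred_eq] at hG ⊢
    simpa using hG.le
  have h5 : Real.exp (2 * (ρ * F.card)) *
      (bernoulliLaw p).real {G | 2 * (ρ * F.card) < ∑ e ∈ F, noise p G e}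
        ≤ Real.exp (ρ * F.card) :=
    (mul_le_mul_of_nonneg_left h4 (Real.exp_pos _).le).trans (h3.trans h1)
  have h6 : Real.exp (ρ * F.card) = Real.exp (2 * (ρ * F.card)) * Real.exp (-(ρ * F.card)) := by
    rw [← Real.exp_add]; ring_nf
  rw [h6] at h5
  exact le_of_mul_le_mul_left h5 (Real.exp_pos _)

/-- The expectation of a maximum of finitely many variables with bounded exponential moments. -/
theorem integral_select_le {Ω Z : Type*} [Finite Ω] [MeasurableSpace Ω]
    [MeasurableSingletonClass Ω] {μ : Measure Ω} [IsProbabilityMeasure μ] [Fintype Z] [Nonempty Z]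
    (X : Z → Ω → ℝ) (sel : Ω → Z) (b : ℝ) (h : ∀ z, ∫ ω, Real.exp (X z ω) ∂μ ≤ Real.exp b) :
    ∫ ω, X (sel ω) ω ∂μ ≤ Real.log (Fintype.card Z) + b := by
  set t := Real.log (Fintype.card Z) + b with ht
  have h1 : ∀ ω, X (sel ω) ω ≤ (t - 1) + Real.exp (-t) * ∑ z, Real.exp (X z ω) := by
    intro ω
    -- The tangent bound for `exp` at the level `t` replaces Jensen's inequality; `t` is chosen so
    -- that the final exponential average is 1.
    have h2 := Real.add_one_le_exp (X (sel ω) ω - t)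
    have h3 : Real.exp (X (sel ω) ω) ≤ ∑ z, Real.exp (X z ω) :=
      Finset.single_le_sum (f := fun z => Real.exp (X z ω)) (fun z _ => (Real.exp_pos _).le)
        (Finset.mem_univ _)
    have h4 : Real.exp (X (sel ω) ω - t) = Real.exp (-t) * Real.exp (X (sel ω) ω) := by
      rw [← Real.exp_add]; ring_nf
    have h5 := mul_le_mul_of_nonneg_left h3 (Real.exp_pos (-t)).le
    linarith
  calc ∫ ω, X (sel ω) ω ∂μ
      ≤ ∫ ω, ((t - 1) + Real.exp (-t) * ∑ z, Real.exp (X z ω)) ∂μ :=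
        integral_mono Integrable.of_finite Integrable.of_finite h1
    _ = (t - 1) + Real.exp (-t) * ∑ z, ∫ ω, Real.exp (X z ω) ∂μ := by
        rw [integral_add Integrable.of_finite Integrable.of_finite, integral_const_mul,
          integral_finsetSum _ fun _ _ => Integrable.of_finite]
        simp
    _ ≤ (t - 1) + Real.exp (-t) * ∑ _z : Z, Real.exp b := by
        gcongr with z; exact h z
    _ = t := by
        have : ∑ _z : Z, Real.exp b = Real.exp t := by
          rw [Finset.sum_const, Finset.card_univ, nsmul_eq_mul, ht, Real.exp_add, Real.exp_log]
          exact_mod_cast Fintype.card_pos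
        rw [this, ← Real.exp_add]; simp

end BernoulliNoise

/-! ### Exponential moments of truncated squares -/

/-- `S ^ 2 / V`, truncated to the range `|S| ≤ 2 * V`. -/
def truncSq (V S : ℝ) : ℝ := if |S| ≤ 2 * V then S ^ 2 / V else 0

/-- The tilts at which the exponential moments of a sum are taken. -/
def tiltLevels (V : ℝ) : Finset (ℕ × Bool) :=
  Finset.range (⌊2 * √V⌋₊ + 1) ×ˢ Finset.univ

/-- The tilt with index `j`. -/
def tilt (V : ℝ) (j : ℕ × Bool) : ℝ := (if j.2 = true then 1 else -1) * (j.1 / (2 * √V))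

/-- The weight of the tilt with index `j`. -/
def tiltWeight (j : ℕ × Bool) : ℝ := Real.exp (((j.1 : ℝ) + 1) ^ 2 / 16 - (j.1 : ℝ) ^ 2 / 2)

/-- The total weight of all tilts. -/
def tiltConst : ℝ := 2 * (Real.exp (1 / 8) * (1 - Real.exp (-(1 / 8)))⁻¹)

theorem tiltConst_pos : 0 < tiltConst := by
  have : Real.exp (-(1 / 8)) < 1 := Real.exp_lt_one_iff.2 (by norm_num)
  have h : 0 < 1 - Real.exp (-(1 / 8)) := by linarith
  unfold tiltConst
  positivity

/-- One term of the sum already dominates: take the sign of `S` and `i = ⌊|S| / √V⌋`. Then `S² / (16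
V) ≤ (i + 1)² / 16`, while tilt times `S` is at least `i² / 2`; the weight is the difference. The
truncation `|S| ≤ 2 V` is what keeps `i ≤ 2√V`, hence the tilt at most 1. -/
theorem exp_truncSq_le {V : ℝ} (hV : 0 ≤ V) (S : ℝ) :
    Real.exp (truncSq V S / 16) ≤
      ∑ j ∈ tiltLevels V, tiltWeight j * Real.exp (tilt V j * S) := by
  have hnn : ∀ j ∈ tiltLevels V, 0 ≤ tiltWeight j * Real.exp (tilt V j * S) := fun j _ =>
    mul_nonneg (Real.exp_pos _).le (Real.exp_pos _).le
  have hzero : truncSq V S = 0 → Real.exp (truncSq V S / 16) ≤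
      ∑ j ∈ tiltLevels V, tiltWeight j * Real.exp (tilt V j * S) := by
    intro h
    have hmem : ((0, true) : ℕ × Bool) ∈ tiltLevels V := by simp [tiltLevels]
    refine le_trans ?_ (Finset.single_le_sum hnn hmem)
    rw [h]
    simp [tilt, tiltWeight]
  by_cases hS : |S| ≤ 2 * V
  swap
  · exact hzero (by simp [truncSq, hS])
  rcases hV.eq_or_lt with hV0 | hV0
  · exact hzero (by simp [truncSq, ← hV0])
  have hs : 0 < √V := Real.sqrt_pos.2 hV0
  have hss : √V * √V = V := Real.mul_self_sqrt hV
  set i := ⌊|S| / √V⌋₊ with hi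
  have hi1 : (i : ℝ) ≤ |S| / √V := Nat.floor_le (by positivity)
  have hi2 : |S| / √V < i + 1 := Nat.lt_floor_add_one _
  have hmem : (i, decide (0 ≤ S)) ∈ tiltLevels V := by
    simp only [tiltLevels, Finset.mem_product, Finset.mem_range, Finset.mem_univ, and_true]
    rw [Nat.lt_succ_iff]
    apply Nat.floor_le_floor
    rw [div_le_iff₀ hs]
    nlinarith
  refine le_trans ?_ (Finset.single_le_sum hnn hmem)
  have htilt : tilt V (i, decide (0 ≤ S)) * S = i / 2 * (|S| / √V) := by
    unfold tilt
    by_cases h : 0 ≤ S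
    · simp [h, abs_of_nonneg h]; field_simp
    · simp [h, abs_of_neg (not_le.1 h)]; field_simp
  rw [htilt, tiltWeight, ← Real.exp_add]
  apply Real.exp_le_exp.2
  have hsq : truncSq V S = (|S| / √V) ^ 2 := by
    rw [truncSq, if_pos hS, div_pow, sq_abs, Real.sq_sqrt hV]
  rw [hsq]
  have h0 : (0 : ℝ) ≤ i := Nat.cast_nonneg _
  have h00 : 0 ≤ |S| / √V := by positivity
  simp only
  nlinarith

/-- Since tilt squared times `V` is at most `j² / 4`, the exponent is at most `(j + 1)² / 16 - j² /
4`, which for integers `j` is at most `(1 - j) / 8`. The series is therefore geometric, uniformly in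
`V`. -/
theorem sum_tiltWeight_le {V : ℝ} (hV : 0 ≤ V) :
    ∑ j ∈ tiltLevels V, tiltWeight j * Real.exp (tilt V j ^ 2 * V) ≤ tiltConst := by
  have h1 : ∀ j ∈ tiltLevels V, tiltWeight j * Real.exp (tilt V j ^ 2 * V) ≤
      Real.exp (1 / 8) * Real.exp (-(1 / 8)) ^ j.1 := by
    intro j _
    rw [tiltWeight, ← Real.exp_add, ← Real.exp_nat_mul, ← Real.exp_add]
    apply Real.exp_le_exp.2
    have h2 : tilt V j ^ 2 * V ≤ (j.1 : ℝ) ^ 2 / 4 := by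
      have h3 : tilt V j ^ 2 = (j.1 : ℝ) ^ 2 / (4 * V) := by
        unfold tilt
        rw [mul_pow, div_pow, mul_pow, Real.sq_sqrt hV]
        split_ifs <;> norm_num
      rw [h3]
      rcases hV.eq_or_lt with hV0 | hV0
      · rw [← hV0]; simp; positivity
      · apply le_of_eq; field_simp
    have h4 : (j.1 : ℝ) ≤ (j.1 : ℝ) ^ 2 := by
      exact_mod_cast Nat.le_self_pow two_ne_zero _
    nlinarith [sq_nonneg ((j.1 : ℝ) - 1)]
  refine (Finset.sum_le_sum h1).trans ?_
  have hlt : Real.exp (-(1 / 8)) < 1 := Real.exp_lt_one_iff.2 (by norm_num)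
  rw [tiltLevels, Finset.sum_product]
  simp only [Finset.sum_const, Finset.card_univ, Fintype.card_bool, nsmul_eq_mul]
  rw [← Finset.mul_sum, ← Finset.mul_sum]
  unfold tiltConst
  push_cast
  gcongr
  rw [← tsum_geometric_of_lt_one (Real.exp_pos _).le hlt]
  exact (summable_geometric_of_lt_one (Real.exp_pos _).le hlt).sum_le_tsum _
    fun _ _ => pow_nonneg (Real.exp_pos _).le _

theorem abs_tilt_le_one {V : ℝ} {j : ℕ × Bool} (hj : j ∈ tiltLevels V) : |tilt V j| ≤ 1 := by
  simp only [tiltLevels, Finset.mem_product, Finset.mem_range, Finset.mem_univ, and_true,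
    Nat.lt_succ_iff] at hj
  have h1 : (j.1 : ℝ) ≤ 2 * √V :=
    (Nat.cast_le.2 hj).trans (Nat.floor_le (by positivity))
  have h2 : |tilt V j| = j.1 / (2 * √V) := by
    unfold tilt
    rw [abs_mul, abs_of_nonneg (by positivity : (0 : ℝ) ≤ j.1 / (2 * √V))]
    split_ifs <;> simp
  rw [h2]
  exact div_le_one_of_le₀ h1 (by positivity)

/-! ### Sums and averages over the cells of a partition -/

section Cells

variable {ι Γ : Type*} [Fintype ι] [DecidableEq Γ]

/-- The cell of the partition `c` with label `α`. -/
def cell (c : ι → Γ) (α : Γ) : Finset ι := {e | c e = α}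

/-- The sum of `v` over the cell with label `α`. -/
def cellSum (c : ι → Γ) (v : ι → ℝ) (α : Γ) : ℝ := ∑ e ∈ cell c α, v e

/-- The average of `v` over the cell of `e`. -/
def cellMean (c : ι → Γ) (v : ι → ℝ) (e : ι) : ℝ := cellSum c v (c e) / (cell c (c e)).card

theorem sum_eq_sum_cells [Fintype Γ] (c : ι → Γ) (g : ι → ℝ) :
    ∑ e, g e = ∑ α, ∑ e ∈ cell c α, g e :=
  (Finset.sum_fiberwise (s := Finset.univ) (g := c) (f := g)).symm

theorem sum_mul_comp_eq [Fintype Γ] (c : ι → Γ) (v : ι → ℝ) (q : Γ → ℝ) :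
    ∑ e, v e * q (c e) = ∑ α, cellSum c v α * q α := by
  rw [sum_eq_sum_cells c]
  refine Finset.sum_congr rfl fun α _ => ?_
  rw [cellSum, Finset.sum_mul]
  refine Finset.sum_congr rfl fun e he => ?_
  rw [(Finset.mem_filter.1 he).2]

theorem sum_comp_eq [Fintype Γ] (c : ι → Γ) (q : Γ → ℝ) :
    ∑ e, q (c e) = ∑ α, (cell c α).card * q α := by
  rw [sum_eq_sum_cells c]
  refine Finset.sum_congr rfl fun α _ => ?_
  rw [← nsmul_eq_mul, ← Finset.sum_const]
  refine Finset.sum_congr rfl fun e he => ?_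
  rw [(Finset.mem_filter.1 he).2]

/-- `cellMean c` is the orthogonal projection onto functions constant on cells. This orthogonality
relation yields the energy identity and the contraction property below. -/
theorem sum_cellMean_mul [Fintype Γ] (c : ι → Γ) (v : ι → ℝ) (q : Γ → ℝ) :
    ∑ e, cellMean c v e * q (c e) = ∑ e, v e * q (c e) := by
  rw [sum_mul_comp_eq c v q]
  have := sum_comp_eq c (fun α => cellSum c v α / (cell c α).card * q α)
  simp only [cellMean]
  rw [this]
  refine Finset.sum_congr rfl fun α _ => ?_
  by_cases h : (cell c α).card = 0
  · have : cell c α = ∅ := Finset.card_eq_zero.1 h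
    simp [cellSum, this]
  · field_simp

theorem sum_cellMean_sq [Fintype Γ] (c : ι → Γ) (v : ι → ℝ) :
    ∑ e, cellMean c v e ^ 2 = ∑ α, cellSum c v α ^ 2 / (cell c α).card := by
  have := sum_comp_eq c (fun α => (cellSum c v α / (cell c α).card) ^ 2)
  simp only [cellMean]
  rw [this]
  refine Finset.sum_congr rfl fun α _ => ?_
  by_cases h : (cell c α).card = 0
  · simp [h]
  · field_simp

theorem sum_mul_cellMean [Fintype Γ] (c : ι → Γ) (v : ι → ℝ) :
    ∑ e, v e * cellMean c v e = ∑ e, cellMean c v e ^ 2 := by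
  have := sum_cellMean_mul c v fun α => cellSum c v α / (cell c α).card
  simp only [sq]
  exact this.symm

theorem sum_cellMean_sq_le [Fintype Γ] (c : ι → Γ) (v : ι → ℝ) :
    ∑ e, cellMean c v e ^ 2 ≤ ∑ e, v e ^ 2 := by
  have h : 0 ≤ ∑ e, (v e - cellMean c v e) ^ 2 := Finset.sum_nonneg fun _ _ => sq_nonneg _
  have h1 : ∑ e, (v e - cellMean c v e) ^ 2
      = ∑ e, v e ^ 2 - 2 * ∑ e, v e * cellMean c v e + ∑ e, cellMean c v e ^ 2 := by
    rw [Finset.mul_sum, ← Finset.sum_sub_distrib, ← Finset.sum_add_distrib]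
    exact Finset.sum_congr rfl fun _ _ => by ring
  rw [h1, sum_mul_cellMean] at h
  linarith

theorem cellSum_sub (c : ι → Γ) (v w : ι → ℝ) (α : Γ) :
    cellSum c (fun e => v e - w e) α = cellSum c v α - cellSum c w α :=
  Finset.sum_sub_distrib _ _

theorem cellMean_comp (c : ι → Γ) (q : Γ → ℝ) (e : ι) :
    cellMean c (fun e => q (c e)) e = q (c e) := by
  unfold cellMean cellSum
  have h : ∑ e' ∈ cell c (c e), q (c e') = (cell c (c e)).card * q (c e) := by
    rw [← nsmul_eq_mul, ← Finset.sum_const]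
    refine Finset.sum_congr rfl fun e' he => ?_
    rw [(Finset.mem_filter.1 he).2]
  have h0 : ((cell c (c e)).card : ℝ) ≠ 0 := by
    have : e ∈ cell c (c e) := by simp [cell]
    exact_mod_cast (Finset.card_pos.2 ⟨e, this⟩).ne'
  rw [h]
  field_simp

theorem cellMean_nonneg (c : ι → Γ) {v : ι → ℝ} (hv : ∀ e, 0 ≤ v e) (e : ι) :
    0 ≤ cellMean c v e :=
  div_nonneg (Finset.sum_nonneg fun e _ => hv e) (Nat.cast_nonneg _)

theorem cellMean_le (c : ι → Γ) {v : ι → ℝ} {ρ : ℝ} (hρ : 0 ≤ ρ) (hv : ∀ e, v e ≤ ρ) (e : ι) :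
    cellMean c v e ≤ ρ := by
  refine div_le_of_le_mul₀ (Nat.cast_nonneg _) hρ ?_
  rw [mul_comm, ← nsmul_eq_mul]
  exact Finset.sum_le_card_nsmul _ _ _ fun e _ => hv e

/-- Truncated squares of the cell sums of centred Bernoulli variables have bounded exponential
moments. -/
theorem integral_exp_sum_truncSq_le [Fintype Γ] {p : ι → I} {ρ : ℝ} (hρ : 0 ≤ ρ)
    (hp : ∀ e, (p e : ℝ) ≤ ρ) (c : ι → Γ) :
    ∫ G, Real.exp (∑ α, truncSq (ρ * (cell c α).card) (cellSum c (noise p G) α) / 16)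
      ∂bernoulliLaw p ≤ tiltConst ^ Fintype.card Γ := by
  classical
  set V : Γ → ℝ := fun α => ρ * (cell c α).card with hVdef
  have hV : ∀ α, 0 ≤ V α := fun α => by positivity
  have h1 : ∀ G, Real.exp (∑ α, truncSq (V α) (cellSum c (noise p G) α) / 16) ≤
      ∑ j ∈ Fintype.piFinset fun α => tiltLevels (V α),
        (∏ α, tiltWeight (j α)) * Real.exp (∑ e, tilt (V (c e)) (j (c e)) * noise p G e) := by
    intro G
    rw [Real.exp_sum]
    refine (Finset.prod_le_prod (fun α _ => (Real.exp_pos _).le)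
      fun α _ => exp_truncSq_le (hV α) (cellSum c (noise p G) α)).trans ?_
    -- Expanding the product selects one tilt per cell, so each term is the exponential of a single
    -- linear form in the noise. The calculation below applies the moment bound to it and then
    -- refolds the sum into a product over cells.
    rw [Finset.prod_univ_sum]
    refine le_of_eq (Finset.sum_congr rfl fun j _ => ?_)
    rw [Finset.prod_mul_distrib, ← Real.exp_sum]
    congr 2
    have := sum_mul_comp_eq c (noise p G) fun α => tilt (V α) (j α)
    simp only [mul_comm] at this ⊢
    exact this.symm
  calc _ ≤ ∫ G, ∑ j ∈ Fintype.piFinset fun α => tiltLevels (V α),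
        (∏ α, tiltWeight (j α)) * Real.exp (∑ e, tilt (V (c e)) (j (c e)) * noise p G e)
          ∂bernoulliLaw p :=
        integral_mono (integrable_bernoulliLaw p _) (integrable_bernoulliLaw p _) h1
    _ = ∑ j ∈ Fintype.piFinset fun α => tiltLevels (V α), (∏ α, tiltWeight (j α)) *
          ∫ G, Real.exp (∑ e, tilt (V (c e)) (j (c e)) * noise p G e) ∂bernoulliLaw p := by
        rw [integral_finsetSum _ fun _ _ => integrable_bernoulliLaw p _]
        exact Finset.sum_congr rfl fun j _ => integral_const_mul _ _
    _ ≤ ∑ j ∈ Fintype.piFinset fun α => tiltLevels (V α), (∏ α, tiltWeight (j α)) *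
          Real.exp (ρ * ∑ e, tilt (V (c e)) (j (c e)) ^ 2) := by
        refine Finset.sum_le_sum fun j hj => ?_
        refine mul_le_mul_of_nonneg_left (integral_exp_noise_le hp _ fun e => ?_)
          (Finset.prod_nonneg fun α _ => (Real.exp_pos _).le)
        exact abs_tilt_le_one (Fintype.mem_piFinset.1 hj (c e))
    _ = ∏ α, ∑ j ∈ tiltLevels (V α), tiltWeight j * Real.exp (tilt (V α) j ^ 2 * V α) := by
        rw [Finset.prod_univ_sum]
        refine Finset.sum_congr rfl fun j _ => ?_
        rw [Finset.prod_mul_distrib, ← Real.exp_sum,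
          sum_comp_eq c fun α => tilt (V α) (j α) ^ 2, Finset.mul_sum]
        congr 2
        exact Finset.sum_congr rfl fun α _ => by simp only [hVdef]; ring
    _ ≤ ∏ _α : Γ, tiltConst := by
        refine Finset.prod_le_prod (fun α _ => Finset.sum_nonneg fun j _ =>
          mul_nonneg (Real.exp_pos _).le (Real.exp_pos _).le) fun α _ => sum_tiltWeight_le (hV α)
    _ = tiltConst ^ Fintype.card Γ := by rw [Finset.prod_const, Finset.card_univ]

end Cells

/-! ### Least squares over a finite family of partitions -/

section LeastSquares

variable {ι Γ Z : Type*} [Fintype ι] [Fintype Γ] [DecidableEq Γ]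

/-- The basic inequality of least squares, with the noise split along the selected partition. -/
theorem basic_inequality (c : ι → Γ) (ε θ θs : ι → ℝ) (q : Γ → ℝ)
    (h : ∑ e, (ε e + θ e - q (c e)) ^ 2 ≤ ∑ e, (ε e + θ e - θs e) ^ 2) :
    ∑ e, (q (c e) - θ e) ^ 2 ≤ 2 * ∑ e, (θs e - θ e) ^ 2 + 8 * ∑ e, cellMean c ε e ^ 2
      + (4 * ∑ e, (cellMean c θ e - θ e) * ε e - ∑ e, (cellMean c θ e - θ e) ^ 2 / 2)
      + 4 * ∑ e, (θ e - θs e) * ε e := by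
  set w : ι → ℝ := fun e => q (c e) - θ e with hw
  have hw1 : ∀ e, cellMean c w e = q (c e) - cellMean c θ e := by
    intro e
    have := cellMean_comp c q e
    rw [← this]
    simp only [cellMean, hw]
    rw [cellSum_sub, sub_div]
  have hP : ∑ e, cellMean c w e ^ 2 ≤ ∑ e, w e ^ 2 := sum_cellMean_sq_le c w
  -- Pythagoras: `w` splits into its projection and `Pθ - θ`, whatever the fitted values `q` are.
  -- Hence only the partition has to be controlled uniformly.
  have hQ : ∑ e, (cellMean c θ e - θ e) ^ 2 = ∑ e, w e ^ 2 - ∑ e, cellMean c w e ^ 2 := by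
    have h1 := sum_mul_cellMean c w
    have h2 : ∀ e, (cellMean c θ e - θ e) ^ 2
        = w e ^ 2 - 2 * (w e * cellMean c w e) + cellMean c w e ^ 2 := by
      intro e; rw [hw1 e]; simp only [hw]; ring
    simp_rw [h2]
    rw [Finset.sum_add_distrib, Finset.sum_sub_distrib, ← Finset.mul_sum, h1]
    ring
  have hnn : 0 ≤ ∑ e, cellMean c w e ^ 2 := Finset.sum_nonneg fun _ _ => sq_nonneg _
  -- After the inequality for `‖w‖²` is doubled, the weight 1/8 leaves `‖Pw‖² / 2` on the right, and
  -- the surplus `‖w‖²` pays for both this and the subtracted `‖Pθ - θ‖² / 2`.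
  have hcross : ∑ e, cellMean c w e * ε e ≤
      2 * ∑ e, cellMean c ε e ^ 2 + (∑ e, cellMean c w e ^ 2) / 8 := by
    have h1 := sum_cellMean_mul c ε fun α => cellSum c w α / (cell c α).card
    have h2 : ∑ e, cellMean c w e * ε e = ∑ e, cellMean c ε e * cellMean c w e := by
      rw [show ∑ e, cellMean c ε e * cellMean c w e = ∑ e, ε e * cellMean c w e from h1]
      exact Finset.sum_congr rfl fun _ _ => mul_comm _ _
    rw [h2, Finset.mul_sum, Finset.sum_div, ← Finset.sum_add_distrib]
    refine Finset.sum_le_sum fun e _ => ?_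
    nlinarith [sq_nonneg (4 * cellMean c ε e - cellMean c w e)]
  have hexp : ∑ e, w e ^ 2 ≤ ∑ e, (θs e - θ e) ^ 2 + 2 * ∑ e, cellMean c w e * ε e
      + 2 * ∑ e, (cellMean c θ e - θ e) * ε e + 2 * ∑ e, (θ e - θs e) * ε e := by
    have h1 : ∑ e, (ε e + θ e - θs e) ^ 2 - ∑ e, (ε e + θ e - q (c e)) ^ 2
        = ∑ e, (θs e - θ e) ^ 2 + 2 * ∑ e, cellMean c w e * ε e
      + 2 * ∑ e, (cellMean c θ e - θ e) * ε e + 2 * ∑ e, (θ e - θs e) * ε e - ∑ e, w e ^ 2 := by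
      simp only [Finset.mul_sum, ← Finset.sum_sub_distrib, ← Finset.sum_add_distrib]
      refine Finset.sum_congr rfl fun e _ => ?_
      rw [hw1 e]; simp only [hw]; ring
    linarith
  have hQ2 : ∑ e, (cellMean c θ e - θ e) ^ 2 / 2 = (∑ e, (cellMean c θ e - θ e) ^ 2) / 2 := by
    rw [Finset.sum_div]
  rw [hQ2, hQ]
  linarith

/-- Only upper deviations can activate the truncation: each noise variable is at least `-ρ`, so a
cell sum is never below `-V`. -/
theorem sum_cellMean_noise_sq_le {p : ι → I} {ρ : ℝ} (hρ : 0 < ρ) (hp : ∀ e, (p e : ℝ) ≤ ρ)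
    (c : ι → Γ) (G : ι → Bool)
    (h : ∀ α, cellSum c (noise p G) α ≤ 2 * (ρ * (cell c α).card)) :
    ∑ e, cellMean c (noise p G) e ^ 2
      = ρ * ∑ α, truncSq (ρ * (cell c α).card) (cellSum c (noise p G) α) := by
  rw [sum_cellMean_sq, Finset.mul_sum]
  refine Finset.sum_congr rfl fun α _ => ?_
  have h1 : -(ρ * (cell c α).card) ≤ cellSum c (noise p G) α := by
    have := Finset.card_nsmul_le_sum (cell c α) (noise p G) (-ρ) fun e _ => neg_le_noise hp G e
    rw [nsmul_eq_mul] at this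
    unfold cellSum
    linarith
  have h2 : 0 ≤ ρ * (cell c α).card := by positivity
  rw [truncSq, if_pos (abs_le.2 ⟨by linarith, h α⟩)]
  by_cases h0 : (cell c α).card = 0
  · simp [h0]
  · field_simp

variable [Fintype Z] [Nonempty Z]

/-- Outside `B` the energy equals `16 ρ` times a sum of truncated squares over 16, to which
`integral_select_le` applies; on `B`, contraction and `|noise| ≤ 1` bound it by the number of
indices. -/
theorem integral_sum_cellMean_noise_sq_le {p : ι → I} {ρ : ℝ} (hρ : 0 < ρ)
    (hp : ∀ e, (p e : ℝ) ≤ ρ) (c : Z → ι → Γ) (sel : (ι → Bool) → Z) (B : Set (ι → Bool))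
    (hB : ∀ G ∉ B, ∀ α,
      cellSum (c (sel G)) (noise p G) α ≤ 2 * (ρ * (cell (c (sel G)) α).card)) :
    ∫ G, ∑ e, cellMean (c (sel G)) (noise p G) e ^ 2 ∂bernoulliLaw p ≤
      16 * ρ * (Real.log (Fintype.card Z) + Fintype.card Γ * Real.log tiltConst)
        + Fintype.card ι * (bernoulliLaw p).real B := by
  classical
  set T : Z → (ι → Bool) → ℝ := fun z G =>
    ∑ α, truncSq (ρ * (cell (c z) α).card) (cellSum (c z) (noise p G) α) / 16 with hT
  have hTnn : ∀ z G, 0 ≤ T z G := by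
    intro z G
    refine Finset.sum_nonneg fun α _ => ?_
    unfold truncSq
    split_ifs
    · positivity
    · simp
  have h1 : ∀ G, ∑ e, cellMean (c (sel G)) (noise p G) e ^ 2 ≤
      16 * ρ * T (sel G) G + Fintype.card ι * B.indicator 1 G := by
    intro G
    by_cases hG : G ∈ B
    · have h2 : ∑ e, cellMean (c (sel G)) (noise p G) e ^ 2 ≤ Fintype.card ι := by
        refine (sum_cellMean_sq_le _ _).trans ?_
        have : ∑ e, noise p G e ^ 2 ≤ ∑ _e : ι, (1 : ℝ) :=
          Finset.sum_le_sum fun e _ => by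
            rw [← sq_abs]
            exact pow_le_one₀ (abs_nonneg _) (abs_noise_le p G e)
        simpa using this
      have := hTnn (sel G) G
      rw [Set.indicator_of_mem hG, Pi.one_apply, mul_one]
      have : 0 ≤ 16 * ρ * T (sel G) G := by positivity
      linarith
    · rw [Set.indicator_of_notMem hG, sum_cellMean_noise_sq_le hρ hp _ G (hB G hG)]
      simp only [hT]
      rw [← Finset.sum_div]
      apply le_of_eq; ring
  have hsel := integral_select_le (μ := bernoulliLaw p) T sel
    (Fintype.card Γ * Real.log tiltConst) (fun z => by
      have := integral_exp_sum_truncSq_le hρ.le hp (c z)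
      rwa [Real.exp_nat_mul, Real.exp_log tiltConst_pos])
  calc _ ≤ ∫ G, (16 * ρ * T (sel G) G + Fintype.card ι * B.indicator 1 G) ∂bernoulliLaw p :=
        integral_mono (integrable_bernoulliLaw p _) (integrable_bernoulliLaw p _) h1
    _ = 16 * ρ * ∫ G, T (sel G) G ∂bernoulliLaw p
          + Fintype.card ι * (bernoulliLaw p).real B := by
        rw [integral_add (integrable_bernoulliLaw p _) (integrable_bernoulliLaw p _),
          integral_const_mul, integral_const_mul, integral_indicator_one B.toFinite.measurableSet]
    _ ≤ _ := by gcongr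

/-- At the tilt `u / (8 ρ)` the moment bound produces exactly `‖u‖² / (64 ρ)`, so the compensated
form has exponential moment at most 1. Rescaling by `32 ρ` gives the expression in the integral. -/
theorem integral_select_inner_le {p : ι → I} {ρ : ℝ} (hρ : 0 < ρ) (hp : ∀ e, (p e : ℝ) ≤ ρ)
    (u : Z → ι → ℝ) (hu : ∀ z e, |u z e| ≤ ρ) (sel : (ι → Bool) → Z) :
    ∫ G, (4 * ∑ e, u (sel G) e * noise p G e - ∑ e, u (sel G) e ^ 2 / 2) ∂bernoulliLaw p
      ≤ 32 * ρ * Real.log (Fintype.card Z) := by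
  set X : Z → (ι → Bool) → ℝ := fun z G =>
    (∑ e, u z e / (8 * ρ) * noise p G e) - (∑ e, u z e ^ 2) / (64 * ρ) with hX
  have h1 := integral_select_le (μ := bernoulliLaw p) X sel 0 (fun z => by
    simp only [hX, Real.exp_sub, div_eq_mul_inv (Real.exp _)]
    rw [integral_mul_const, ← Real.exp_neg]
    have h2 := integral_exp_noise_le hp (fun e => u z e / (8 * ρ)) (fun e => by
      rw [abs_div, abs_of_pos (by positivity : 0 < 8 * ρ)]
      exact div_le_one_of_le₀ (by linarith [hu z e]) (by positivity))
    refine (mul_le_mul_of_nonneg_right h2 (Real.exp_pos _).le).trans ?_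
    rw [← Real.exp_add]
    apply Real.exp_le_exp.2
    simp_rw [div_pow]
    rw [← Finset.sum_div]
    apply le_of_eq
    field_simp
    ring)
  have h2 : ∀ G, 4 * ∑ e, u (sel G) e * noise p G e - ∑ e, u (sel G) e ^ 2 / 2
      = 32 * ρ * X (sel G) G := by
    intro G
    simp only [hX]
    rw [← Finset.sum_div]
    have : ∑ e, u (sel G) e / (8 * ρ) * noise p G e
        = (∑ e, u (sel G) e * noise p G e) / (8 * ρ) := by
      rw [Finset.sum_div]
      exact Finset.sum_congr rfl fun e _ => by ring
    rw [this]
    field_simp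
    ring
  simp_rw [h2]
  rw [integral_const_mul]
  rw [add_zero] at h1
  gcongr

/-- Risk bound for least squares over a finite family of partitions, with Bernoulli noise of
parameters at most `ρ`; `B` is an event outside of which all cell means are of order `ρ`. -/
theorem integral_leastSquares_le {p : ι → I} {ρ : ℝ} (hρ : 0 < ρ) (hp : ∀ e, (p e : ℝ) ≤ ρ)
    (c : Z → ι → Γ) (sel : (ι → Bool) → Z) (q : (ι → Bool) → Γ → ℝ) (θs : ι → ℝ)
    (hls : ∀ G, ∑ e, ((if G e = true then 1 else 0) - q G (c (sel G) e)) ^ 2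
      ≤ ∑ e, ((if G e = true then 1 else 0) - θs e) ^ 2)
    (B : Set (ι → Bool))
    (hB : ∀ G ∉ B, ∀ α,
      cellSum (c (sel G)) (noise p G) α ≤ 2 * (ρ * (cell (c (sel G)) α).card)) :
    ∫ G, ∑ e, (q G (c (sel G) e) - p e) ^ 2 ∂bernoulliLaw p ≤
      2 * ∑ e, (θs e - p e) ^ 2 + 160 * ρ * Real.log (Fintype.card Z)
        + 128 * ρ * (Fintype.card Γ * Real.log tiltConst)
        + 8 * (Fintype.card ι * (bernoulliLaw p).real B) := by
  have h0 : ∀ G, ∑ e, (q G (c (sel G) e) - p e) ^ 2 ≤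
      2 * ∑ e, (θs e - p e) ^ 2 + 8 * ∑ e, cellMean (c (sel G)) (noise p G) e ^ 2
      + (4 * ∑ e, (cellMean (c (sel G)) (fun e => (p e : ℝ)) e - p e) * noise p G e
        - ∑ e, (cellMean (c (sel G)) (fun e => (p e : ℝ)) e - p e) ^ 2 / 2)
      + 4 * ∑ e, ((p e : ℝ) - θs e) * noise p G e := by
    intro G
    refine basic_inequality (c (sel G)) (noise p G) (fun e => (p e : ℝ)) θs (q G) ?_
    simpa only [noise, sub_add_cancel] using hls G
  have h1 := integral_sum_cellMean_noise_sq_le hρ hp c sel B hB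
  have h2 := integral_select_inner_le hρ hp
    (fun z e => cellMean (c z) (fun e => (p e : ℝ)) e - p e) (fun z e => by
      have a1 := cellMean_nonneg (c z) (v := fun e => (p e : ℝ)) (fun e => (p e).2.1) e
      have a2 := cellMean_le (c z) (v := fun e => (p e : ℝ)) hρ.le hp e
      have a3 := (p e).2.1
      have a4 := hp e
      rw [abs_le]; constructor <;> linarith) sel
  have h3 := integral_noise p fun e => (p e : ℝ) - θs e
  calc _ ≤ _ := integral_mono (integrable_bernoulliLaw p _) (integrable_bernoulliLaw p _) h0
    _ = 2 * ∑ e, (θs e - p e) ^ 2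
        + 8 * ∫ G, ∑ e, cellMean (c (sel G)) (noise p G) e ^ 2 ∂bernoulliLaw p
        + ∫ G, (4 * ∑ e, (cellMean (c (sel G)) (fun e => (p e : ℝ)) e - p e) * noise p G e
            - ∑ e, (cellMean (c (sel G)) (fun e => (p e : ℝ)) e - p e) ^ 2 / 2) ∂bernoulliLaw p
        + 4 * ∫ G, ∑ e, ((p e : ℝ) - θs e) * noise p G e ∂bernoulliLaw p := by
        rw [integral_add (integrable_bernoulliLaw p _) (integrable_bernoulliLaw p _),
          integral_add (integrable_bernoulliLaw p _) (integrable_bernoulliLaw p _),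
          integral_add (integrable_bernoulliLaw p _) (integrable_bernoulliLaw p _),
          integral_const_mul, integral_const_mul, integral_const_mul, integral_const]
        simp
    -- The entropy constant is `160 = 8 * 16 + 32`.
    _ ≤ _ := by rw [h3]; linarith

end LeastSquares

/-! ### Hyperedges with a prescribed pattern of blocks -/

/-- Greedy choice: when the `i`-th entry is chosen, at most `i` elements of `B i` are already used.
The sets may overlap or coincide. -/
theorem prod_card_sub_le {α : Type*} [DecidableEq α] : ∀ (m : ℕ) (B : Fin m → Finset α),
    ∏ i, ((B i).card - (i : ℕ)) ≤
      (Finset.filter (fun j : Fin m → α => Function.Injective j) (Fintype.piFinset B)).card := by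
  intro m
  induction m with
  | zero =>
    intro B
    simp only [Finset.univ_eq_empty, Finset.prod_empty]
    apply Finset.card_pos.2
    exact ⟨default, by simp [Function.injective_of_subsingleton]⟩
  | succ m ih =>
    intro B
    rw [Fin.prod_univ_castSucc]
    set S := Finset.filter (fun j : Fin m → α => Function.Injective j)
      (Fintype.piFinset fun i => B i.castSucc) with hS
    have h1 := ih fun i => B i.castSucc
    have h2 : S.card * ((B (Fin.last m)).card - m) ≤
        (S.sigma fun j => B (Fin.last m) \ Finset.univ.image j).card := by
      rw [Finset.card_sigma, ← smul_eq_mul]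
      refine Finset.card_nsmul_le_sum _ _ _ fun j _ => ?_
      refine le_trans ?_ (Finset.le_card_sdiff _ _)
      have : (Finset.univ.image j).card ≤ m := by
        simpa using Finset.card_image_le (s := Finset.univ) (f := j)
      omega
    simp only [Fin.val_castSucc, Fin.val_last]
    refine (Nat.mul_le_mul_right _ h1).trans (h2.trans ?_)
    refine Finset.card_le_card_of_injOn
      (fun p => (Fin.snoc (α := fun _ => α) p.1 p.2 : Fin (m + 1) → α)) ?_ ?_
    · rintro ⟨j, y⟩ hjy
      simp only [Finset.coe_sigma, Set.mem_sigma_iff, Finset.mem_coe, Finset.mem_sdiff,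
        Finset.mem_image, Finset.mem_univ, true_and, hS, Finset.mem_filter,
        Fintype.mem_piFinset] at hjy
      obtain ⟨⟨hj, hinj⟩, hy, hny⟩ := hjy
      simp only [Finset.coe_filter, Fintype.mem_piFinset, Set.mem_ofPred_eq]
      refine ⟨fun i => ?_, ?_⟩
      · refine Fin.lastCases ?_ (fun i => ?_) i
        · simpa using hy
        · simpa using hj i
      · rw [Fin.snoc_injective_iff]
        exact ⟨hinj, fun ⟨i, hi⟩ => hny ⟨i, hi⟩⟩
    · rintro ⟨j, y⟩ _ ⟨j', y'⟩ _ h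
      simp only at h
      have h1 : j = j' := by
        funext i
        simpa using congrFun h i.castSucc
      have h2 : y = y' := by simpa using congrFun h (Fin.last m)
      subst h1 h2
      rfl

variable {m n k : ℕ}

open Classical in
/-- The hyperedges whose vertices can be arranged so that the `i`-th lies in `B i`. -/
def patternEdges (B : Fin m → Finset (Fin n)) : Finset (Edge m n) :=
  {e | ∃ τ : Equiv.Perm (Fin m), ∀ i, e.1 (τ i) ∈ B i}

theorem strictMono_comp_sort {j : Fin m → Fin n} (hj : Function.Injective j) :
    StrictMono (j ∘ Tuple.sort j) :=
  (Tuple.monotone_sort j).strictMono_of_injective (hj.comp (Tuple.sort j).injective)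

theorem prod_card_sub_le_patternEdges (B : Fin m → Finset (Fin n)) :
    ∏ i, ((B i).card - (i : ℕ)) ≤ m.factorial * (patternEdges B).card := by
  classical
  refine (prod_card_sub_le m B).trans ?_
  have h : (patternEdges B ×ˢ (Finset.univ : Finset (Equiv.Perm (Fin m)))).card
      = m.factorial * (patternEdges B).card := by
    rw [Finset.card_product, Finset.card_univ, Fintype.card_perm, Fintype.card_fin, mul_comm]
  rw [← h]
  refine Finset.card_le_card_of_surjOn (fun q => q.1.1 ∘ q.2) ?_
  intro j hj
  simp only [Finset.coe_filter, Fintype.mem_piFinset, Set.mem_ofPred_eq] at hj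
  obtain ⟨hj, hinj⟩ := hj
  have hj2 : (j ∘ Tuple.sort j) ∘ ⇑(Tuple.sort j)⁻¹ = j := by
    funext i; simp
  refine ⟨(⟨j ∘ Tuple.sort j, strictMono_comp_sort hinj⟩, (Tuple.sort j)⁻¹), ?_, hj2⟩
  simp only [Finset.coe_product, Set.mem_prod, Finset.mem_coe, Finset.mem_univ, and_true,
    patternEdges, Finset.mem_filter, true_and]
  exact ⟨(Tuple.sort j)⁻¹, fun i => by simpa using hj i⟩

/-- The label of a hyperedge under the assignment `z`: its tuple of blocks, sorted. -/
def blockLabel (z : Fin n → Fin k) (e : Edge m n) : Fin m → Fin k :=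
  (z ∘ e.1) ∘ Tuple.sort (z ∘ e.1)

theorem blockLabel_eq_iff (z : Fin n → Fin k) (e : Edge m n) {α : Fin m → Fin k}
    (hα : α ∘ Tuple.sort α = α) :
    blockLabel z e = α ↔ ∃ τ : Equiv.Perm (Fin m), ∀ i, z (e.1 (τ i)) = α i := by
  constructor
  · intro h
    exact ⟨Tuple.sort (z ∘ e.1), fun i => congrFun h i⟩
  · rintro ⟨τ, hτ⟩
    have h : (z ∘ e.1) ∘ τ = α := funext hτ
    have h1 : ((z ∘ e.1) ∘ τ) ∘ Tuple.sort ((z ∘ e.1) ∘ τ) = (z ∘ e.1) ∘ Tuple.sort (z ∘ e.1) :=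
      Tuple.comp_perm_comp_sort_eq_comp_sort
    rw [h, hα] at h1
    exact h1.symm

/-- Sorting the labels makes a nonempty cell consist of all hyperedges with a given pattern of
blocks. Labelling by `z ∘ e` instead would split it according to the order of the vertices and could
produce tiny cells. Unsorted labels have empty cells. -/
theorem cell_blockLabel (z : Fin n → Fin k) (α : Fin m → Fin k) :
    cell (blockLabel (m := m) z) α = ∅ ∨
      cell (blockLabel z) α = patternEdges fun i => Finset.univ.filter fun v => z v = α i := by
  classical
  by_cases hα : α ∘ Tuple.sort α = α
  · right
    ext e
    simp [cell, patternEdges, blockLabel_eq_iff z e hα]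
  · left
    ext e
    simp only [cell, Finset.mem_filter, Finset.mem_univ, true_and, Finset.notMem_empty, iff_false]
    rintro rfl
    apply hα
    exact Tuple.comp_perm_comp_sort_eq_comp_sort

/-- As `n₀ ≥ 2 m`, each factor `|B i| - i` is at least `|B i| / 2`, so the pattern holds at least `∏
|B i| / (m! 2 ^ m)` hyperedges; and each `|B i|` is at most `∏ |B j| / n₀ ^ (m - 1)`. This makes the
Chernoff exponent beat the entropy of the blocks. -/
theorem sum_card_mul_log_le_patternEdges {ρ : ℝ} (hρ : 0 ≤ ρ) {n₀ : ℕ}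
    (hm : 1 ≤ m) (hn₀ : 2 * m ≤ n₀)
    (H : 2 * (m.factorial * 2 ^ m * m) * Real.log n ≤ ρ * n₀ ^ (m - 1))
    (B : Fin m → Finset (Fin n)) (hB : ∀ i, n₀ ≤ (B i).card) :
    2 * Real.log n * ∑ i, ((B i).card : ℝ) ≤ ρ * (patternEdges B).card := by
  have hm' : (0 : ℝ) < m := by exact_mod_cast hm
  have hf : (0 : ℝ) < m.factorial := by exact_mod_cast m.factorial_pos
  have h1 : ∏ i, ((B i).card : ℝ) ≤ m.factorial * 2 ^ m * (patternEdges B).card := by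
    have h2 : ∏ i, ((B i).card : ℝ) / 2 ≤ ((∏ i, ((B i).card - (i : ℕ)) : ℕ) : ℝ) := by
      push_cast
      refine Finset.prod_le_prod (fun i _ => by positivity) fun i _ => ?_
      have h3 := hB i
      have h4 := i.2
      rw [Nat.cast_sub (by omega)]
      have h5 : 2 * (i : ℕ) ≤ (B i).card := by omega
      have h6 : 2 * ((i : ℕ) : ℝ) ≤ (B i).card := by exact_mod_cast h5
      linarith
    have h3 : ((∏ i, ((B i).card - (i : ℕ)) : ℕ) : ℝ) ≤ m.factorial * (patternEdges B).card := by
      exact_mod_cast prod_card_sub_le_patternEdges B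
    have h4 := h2.trans h3
    rw [Finset.prod_div_distrib, Finset.prod_const, Finset.card_univ, Fintype.card_fin,
      div_le_iff₀ (by positivity)] at h4
    linarith
  have h2 : (n₀ : ℝ) ^ (m - 1) * ∑ i, ((B i).card : ℝ) ≤ m * ∏ i, ((B i).card : ℝ) := by
    rw [Finset.mul_sum]
    have : ∀ i ∈ (Finset.univ : Finset (Fin m)),
        (n₀ : ℝ) ^ (m - 1) * ((B i).card : ℝ) ≤ ∏ i, ((B i).card : ℝ) := by
      intro i _
      rw [← Finset.prod_erase_mul _ _ (Finset.mem_univ i)]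
      refine mul_le_mul_of_nonneg_right ?_ (Nat.cast_nonneg _)
      calc (n₀ : ℝ) ^ (m - 1) = ∏ _j ∈ Finset.univ.erase i, (n₀ : ℝ) := by
            rw [Finset.prod_const, Finset.card_erase_of_mem (Finset.mem_univ i), Finset.card_univ,
              Fintype.card_fin]
        _ ≤ _ := Finset.prod_le_prod (fun _ _ => Nat.cast_nonneg _)
            fun j _ => by exact_mod_cast hB j
    simpa using Finset.sum_le_card_nsmul _ _ _ this
  have hS : 0 ≤ ∑ i, ((B i).card : ℝ) := Finset.sum_nonneg fun _ _ => Nat.cast_nonneg _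
  have h3 := mul_le_mul_of_nonneg_right H hS
  have h4 := mul_le_mul_of_nonneg_left h2 hρ
  have h5 := mul_le_mul_of_nonneg_left h1 (mul_nonneg hρ hm'.le)
  have hc : (0 : ℝ) < m.factorial * 2 ^ m * m := by positivity
  refine le_of_mul_le_mul_left ?_ hc
  nlinarith

/-- Each coordinate contributes `(1 + 1/n) ^ n ≤ e`. The weights `n ^ (-|B i|)` make the union bound
over all families of blocks summable. -/
theorem sum_inv_pow_card (n : ℕ) (hn : 1 ≤ n) :
    ∑ B : Fin m → Finset (Fin n), ∏ i, ((n : ℝ)⁻¹) ^ (B i).card ≤ Real.exp m := by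
  classical
  have h1 : ∑ B : Fin m → Finset (Fin n), ∏ i, ((n : ℝ)⁻¹) ^ (B i).card
      = ∏ _i : Fin m, ∑ s : Finset (Fin n), ((n : ℝ)⁻¹) ^ s.card := by
    rw [Finset.prod_univ_sum, Fintype.piFinset_univ]
  have h2 : ∑ s : Finset (Fin n), ((n : ℝ)⁻¹) ^ s.card = ((n : ℝ)⁻¹ + 1) ^ n := by
    have := Fintype.sum_pow_mul_eq_add_pow (Fin n) ((n : ℝ)⁻¹) 1
    simpa using this
  have h3 : ((n : ℝ)⁻¹ + 1) ^ n ≤ Real.exp 1 := by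
    have hn' : (n : ℝ) ≠ 0 := by positivity
    calc ((n : ℝ)⁻¹ + 1) ^ n ≤ Real.exp ((n : ℝ)⁻¹) ^ n := by
          gcongr; exact Real.add_one_le_exp _
      _ = Real.exp 1 := by rw [← Real.exp_nat_mul]; field_simp
  rw [h1, Finset.prod_const, h2, Finset.card_univ, Fintype.card_fin]
  calc (((n : ℝ)⁻¹ + 1) ^ n) ^ m ≤ Real.exp 1 ^ m := by gcongr
    _ = Real.exp m := by rw [← Real.exp_nat_mul, mul_one]

/-- With high probability, no set of possible hyperedges prescribed by a pattern of large
blocks contains more than three times the largest possible expected number of hyperedges. -/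
theorem measureReal_pattern_deviation_le {p : Edge m n → I} {ρ : ℝ} (hρ : 0 ≤ ρ)
    (hp : ∀ e, (p e : ℝ) ≤ ρ) {n₀ : ℕ} (hn : 1 ≤ n) (hm : 1 ≤ m) (hn₀ : 2 * m ≤ n₀)
    (H : 2 * (m.factorial * 2 ^ m * m) * Real.log n ≤ ρ * n₀ ^ (m - 1)) :
    (bernoulliLaw p).real {G | ∃ B : Fin m → Finset (Fin n), (∀ i, n₀ ≤ (B i).card) ∧
      2 * (ρ * (patternEdges B).card) < ∑ e ∈ patternEdges B, noise p G e}
      ≤ Real.exp m * ((n : ℝ)⁻¹) ^ m := by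
  classical
  have hn' : (0 : ℝ) < n := by exact_mod_cast hn
  set S : Finset (Fin m → Finset (Fin n)) := Finset.univ.filter fun B => ∀ i, n₀ ≤ (B i).card
    with hS
  have h1 : {G | ∃ B : Fin m → Finset (Fin n), (∀ i, n₀ ≤ (B i).card) ∧
      2 * (ρ * (patternEdges B).card) < ∑ e ∈ patternEdges B, noise p G e}
      = ⋃ B ∈ S, {G | 2 * (ρ * (patternEdges B).card) < ∑ e ∈ patternEdges B, noise p G e} := by
    ext G; simp [hS]
  rw [h1]
  refine (measureReal_biUnion_finset_le _ _).trans ?_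
  have h2 : ∀ B ∈ S, (bernoulliLaw p).real
      {G | 2 * (ρ * (patternEdges B).card) < ∑ e ∈ patternEdges B, noise p G e} ≤
      ((n : ℝ)⁻¹) ^ m * ∏ i, ((n : ℝ)⁻¹) ^ (B i).card := by
    intro B hB
    have hB' : ∀ i, n₀ ≤ (B i).card := (Finset.mem_filter.1 hB).2
    refine (measureReal_noise_sum_gt_le hp _).trans ?_
    have h3 := sum_card_mul_log_le_patternEdges hρ hm hn₀ H B hB'
    have h4 : ∀ c : ℕ, ((n : ℝ)⁻¹) ^ c = Real.exp (-(c * Real.log n)) := by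
      intro c
      rw [← mul_neg, Real.exp_nat_mul, Real.exp_neg, Real.exp_log hn']
    rw [Finset.prod_pow_eq_pow_sum, ← pow_add, h4]
    apply Real.exp_le_exp.2
    -- One half of the exponent `2 log n ∑ |B i|` pays for the weights, the other half for the
    -- factor `n ^ (-m)`.
    have h5 : (m : ℝ) ≤ ∑ i, ((B i).card : ℝ) := by
      have : ∑ _i : Fin m, (1 : ℝ) ≤ ∑ i, ((B i).card : ℝ) :=
        Finset.sum_le_sum fun i _ => by
          have := hB' i
          exact_mod_cast (by omega : 1 ≤ (B i).card)
      simpa using this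
    have hlog : 0 ≤ Real.log n := Real.log_natCast_nonneg n
    push_cast
    nlinarith
  refine (Finset.sum_le_sum h2).trans ?_
  rw [← Finset.mul_sum, mul_comm]
  refine mul_le_mul_of_nonneg_right ?_ (by positivity)
  refine le_trans ?_ (sum_inv_pow_card (m := m) n hn)
  exact Finset.sum_le_sum_of_subset_of_nonneg (Finset.subset_univ _)
    fun B _ _ => Finset.prod_nonneg fun i _ => by positivity

/-! ### The risk given the latent positions -/

theorem adjacency_edge (G : Hypergraph m n) (e : Edge m n) :
    adjacency G e.1 = if G e = true then 1 else 0 := by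
  unfold adjacency
  have h : (∃ e' : Edge m n, Set.range e'.1 = Set.range e.1 ∧ G e' = true) ↔ G e = true := by
    constructor
    · rintro ⟨e', h1, h2⟩
      have h3 : e'.1 = e.1 := (StrictMono.range_inj e'.2 e.2).1 h1
      rwa [Subtype.ext h3] at h2
    · exact fun h => ⟨e, rfl, h⟩
  simp only [h]

theorem loss_eq (A : Tensor m n) (z : Fin n → Fin k) (Q : Tensor m k) :
    loss A z Q = ∑ e : Edge m n, (A e.1 - Q (z ∘ e.1)) ^ 2 := by
  classical
  unfold loss
  have h1 : ∀ a : Fin m → Fin k,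
      ∑ j : Fin m → Fin n with StrictMono j ∧ z ∘ j = a, (A j - Q a) ^ 2
        = ∑ j ∈ (Finset.univ.filter fun j : Fin m → Fin n => StrictMono j) with z ∘ j = a,
          (A j - Q (z ∘ j)) ^ 2 := by
    intro a
    rw [Finset.filter_filter]
    refine Finset.sum_congr (by congr) fun j hj => ?_
    rw [((Finset.mem_filter.1 hj).2).2]
  simp_rw [h1]
  rw [Finset.sum_fiberwise]
  exact Finset.sum_subtype _ (by simp) _

theorem apply_blockLabel {Q : Tensor m k} (hQ : Q ∈ blockTensors m k) (z : Fin n → Fin k)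
    (e : Edge m n) : Q (blockLabel z e) = Q (z ∘ e.1) := hQ.2 _ _

theorem sum_injective_le (g : (Fin m → Fin n) → ℝ) (h0 : ∀ j, 0 ≤ g j)
    (hsymm : ∀ (τ : Equiv.Perm (Fin m)) j, g (j ∘ τ) = g j)
    (hinj : ∀ j, ¬ Function.Injective j → g j = 0) :
    ∑ j, g j ≤ m.factorial * ∑ e : Edge m n, g e.1 := by
  classical
  have h1 : (m.factorial : ℝ) * ∑ e : Edge m n, g e.1
      = ∑ q : Edge m n × Equiv.Perm (Fin m), g (q.1.1 ∘ q.2) := by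
    rw [Fintype.sum_prod_type, Finset.mul_sum]
    refine Finset.sum_congr rfl fun e _ => ?_
    simp [hsymm, Finset.card_univ, Fintype.card_perm]
  rw [h1, ← Finset.sum_fiberwise (s := Finset.univ)
    (g := fun q : Edge m n × Equiv.Perm (Fin m) => q.1.1 ∘ q.2)]
  refine Finset.sum_le_sum fun j _ => ?_
  by_cases hj : Function.Injective j
  · have hj2 : (j ∘ Tuple.sort j) ∘ ⇑(Tuple.sort j)⁻¹ = j := by
      funext i; simp
    let q : Edge m n × Equiv.Perm (Fin m) :=
      (⟨j ∘ Tuple.sort j, strictMono_comp_sort hj⟩, (Tuple.sort j)⁻¹)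
    have hq : q.1.1 ∘ q.2 = j := hj2
    have := Finset.single_le_sum (s := Finset.univ.filter
      fun q : Edge m n × Equiv.Perm (Fin m) => q.1.1 ∘ q.2 = j)
      (f := fun q => g (q.1.1 ∘ q.2)) (fun q _ => h0 _) (Finset.mem_filter.2 ⟨Finset.mem_univ q, hq⟩)
    simpa only [hq] using this
  · rw [hinj j hj]
    exact Finset.sum_nonneg fun q _ => h0 _

theorem frobeniusSq_sub_le {L : ℝ} {f : (Fin m → I) → I} (hf : IsSLH L f) (ρ : I)
    (x : Fin n → I) (z : Fin n → Fin k) {Q : Tensor m k} (hQ : Q ∈ blockTensors m k) :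
    frobeniusSq (blockModel z Q - trueTensor ρ f x) ≤
      m.factorial * ∑ e : Edge m n, (Q (z ∘ e.1) - (ρ * f (x ∘ e.1) : I)) ^ 2 := by
  classical
  have h := sum_injective_le (m := m) (n := n)
    (fun j => (blockModel z Q - trueTensor ρ f x) j ^ 2) (fun j => sq_nonneg _) (fun τ j => by
      have h1 : Function.Injective (j ∘ τ) ↔ Function.Injective j :=
        Function.Injective.of_comp_iff' j τ.bijective
      have h2 : Q (z ∘ j ∘ τ) = Q (z ∘ j) := hQ.2 τ (z ∘ j)
      have h3 : f (x ∘ j ∘ τ) = f (x ∘ j) := hf.symmetric τ (x ∘ j)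
      simp only [Pi.sub_apply, blockModel, trueTensor, h1, h2, h3])
    (fun j hj => by simp [blockModel, trueTensor, hj])
  refine h.trans (le_of_eq ?_)
  congr 1
  refine Finset.sum_congr rfl fun e _ => ?_
  simp [blockModel, trueTensor, e.2.injective]

theorem card_edge_le (m n : ℕ) : Fintype.card (Edge m n) ≤ n ^ m := by
  classical
  have := Fintype.card_le_of_injective (fun e : Edge m n => e.1) Subtype.val_injective
  simpa using this

/-- The risk of the least-squares estimator given the latent positions, in terms of the
approximation error of any block model. -/
theorem integral_frobeniusSq_le {L : ℝ} {f : (Fin m → I) → I} (hf : IsSLH L f) {ρ : I}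
    (hρ : 0 < (ρ : ℝ)) {n₀ : ℕ} (hn : 1 ≤ n) (hm : 1 ≤ m) (hn₀ : 2 * m ≤ n₀)
    (H : 2 * (m.factorial * 2 ^ m * m) * Real.log n ≤ ρ * n₀ ^ (m - 1))
    {zhat : Hypergraph m n → Fin n → Fin k} {Qhat : Hypergraph m n → Tensor m k}
    (hls : ∀ G, IsLeastSquares n₀ (adjacency G) (zhat G) (Qhat G))
    (x : Fin n → I) {zs : Fin n → Fin k} (hzs : zs ∈ balancedAssignments n k n₀)
    {Qs : Tensor m k} (hQs : Qs ∈ blockTensors m k) :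
    ∫ G, frobeniusSq (blockModel (zhat G) (Qhat G) - trueTensor ρ f x) ∂edgeLaw ρ f x ≤
      m.factorial * (2 * ∑ e : Edge m n, (Qs (zs ∘ e.1) - (ρ * f (x ∘ e.1) : I)) ^ 2
        + 160 * ρ * (n * Real.log k) + 128 * ρ * (k ^ m * Real.log tiltConst)
        + 8 * Real.exp m) := by
  classical
  have hn' : (0 : ℝ) < n := by exact_mod_cast hn
  set p : Edge m n → I := fun e => ρ * f (x ∘ e.1) with hpdef
  have hp : ∀ e, (p e : ℝ) ≤ ρ := fun e => by
    simp only [hpdef, Set.Icc.coe_mul]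
    exact mul_le_of_le_one_right ρ.2.1 (f (x ∘ e.1)).2.2
  have hlaw : edgeLaw ρ f x = bernoulliLaw p := rfl
  rw [hlaw]
  set B : Set (Hypergraph m n) := {G | ∃ B : Fin m → Finset (Fin n), (∀ i, n₀ ≤ (B i).card) ∧
      2 * ((ρ : ℝ) * (patternEdges B).card) < ∑ e ∈ patternEdges B, noise p G e} with hBdef
  have hPB := measureReal_pattern_deviation_le hρ.le hp hn hm hn₀ H
  have hB : ∀ G ∉ B, ∀ α, cellSum (blockLabel (zhat G)) (noise p G) α
      ≤ 2 * ((ρ : ℝ) * (cell (blockLabel (m := m) (zhat G)) α).card) := by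
    intro G hG α
    rcases cell_blockLabel (m := m) (zhat G) α with h | h
    · simp [cellSum, h]
    · by_contra hlt
      refine hG ⟨fun i => Finset.univ.filter fun v => zhat G v = α i, fun i => ?_, ?_⟩
      · have h1 := (hls G).assignment_mem (α i)
        have h2 : (zhat G ⁻¹' {α i}) =
            ((Finset.univ.filter fun v => zhat G v = α i : Finset (Fin n)) : Set (Fin n)) := by
          ext v; simp
        rwa [h2, Set.ncard_coe_finset] at h1
      · rw [not_le, cellSum, h] at hlt
        exact hlt
  have : Nonempty (Fin n → Fin k) := ⟨zs⟩
  have hrisk := integral_leastSquares_le hρ hp (fun z : Fin n → Fin k => blockLabel (m := m) z)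
    zhat Qhat (fun e => Qs (zs ∘ e.1)) (fun G => by
      have h1 := (hls G).loss_le zs hzs Qs hQs
      rw [loss_eq, loss_eq] at h1
      simp_rw [adjacency_edge] at h1
      simpa only [apply_blockLabel (hls G).tensor_mem] using h1) B hB
  have hcardZ : Real.log (Fintype.card (Fin n → Fin k)) = n * Real.log k := by
    simp [Real.log_pow]
  have hcardΓ : (Fintype.card (Fin m → Fin k) : ℝ) = (k : ℝ) ^ m := by simp
  -- The exceptional event has probability of order `n ^ (-m)`, which cancels the trivial bound by
  -- the number of hyperedges.
  have hN : Fintype.card (Edge m n) * (bernoulliLaw p).real B ≤ Real.exp m := by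
    calc Fintype.card (Edge m n) * (bernoulliLaw p).real B
        ≤ (n : ℝ) ^ m * (Real.exp m * ((n : ℝ)⁻¹) ^ m) := by
          refine mul_le_mul ?_ hPB measureReal_nonneg (by positivity)
          exact_mod_cast card_edge_le m n
      _ = Real.exp m := by
          rw [inv_pow]; field_simp
  rw [hcardZ, hcardΓ] at hrisk
  calc _ ≤ ∫ G, m.factorial *
          ∑ e, (Qhat G (blockLabel (zhat G) e) - (p e : ℝ)) ^ 2 ∂bernoulliLaw p := by
        refine integral_mono (integrable_bernoulliLaw p _) (integrable_bernoulliLaw p _) fun G => ?_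
        simp only [apply_blockLabel (hls G).tensor_mem]
        exact frobeniusSq_sub_le hf ρ x (zhat G) (hls G).tensor_mem
    _ = m.factorial * ∫ G,
          ∑ e, (Qhat G (blockLabel (zhat G) e) - (p e : ℝ)) ^ 2 ∂bernoulliLaw p :=
        integral_const_mul _ _
    _ ≤ _ := by
        refine mul_le_mul_of_nonneg_left ?_ (Nat.cast_nonneg _)
        linarith

/-! ### Blocks of consecutive order statistics -/

theorem block_bounds (hn : 0 < n) (r a : ℕ) :
    r * k / n = a ↔ a * n ≤ r * k ∧ r * k < (a + 1) * n := by
  rw [Nat.div_eq_iff hn]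
  constructor
  · rintro ⟨h1, h2⟩
    refine ⟨h1, ?_⟩
    have : (a + 1) * n = a * n + n := by ring
    omega
  · rintro ⟨h1, h2⟩
    refine ⟨h1, ?_⟩
    have : (a + 1) * n = a * n + n := by ring
    omega

theorem le_card_block (hk : 0 < k) (hkn : k ≤ n) {a : ℕ} (ha : a < k) :
    n / k ≤ (Finset.univ.filter fun r : Fin n => (r : ℕ) * k / n = a).card := by
  have hn : 0 < n := by omega
  -- `r₀ = ⌈a n / k⌉` is the first rank of block `a`; the ranks from `r₀` to `r₀ + n / k - 1` all
  -- belong to it.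
  set r₀ := (a * n + (k - 1)) / k with hr₀
  have h1 : r₀ * k ≤ a * n + (k - 1) := Nat.div_mul_le_self _ _
  have h2 : a * n ≤ r₀ * k := by
    have := Nat.lt_div_mul_add (a := a * n + (k - 1)) hk
    rw [← hr₀] at this
    omega
  have h3 : n / k * k ≤ n := Nat.div_mul_le_self _ _
  have h4 : (a + 1) * n ≤ k * n := Nat.mul_le_mul_right _ ha
  have key : ∀ i, i < n / k → a * n ≤ (r₀ + i) * k ∧ (r₀ + i) * k < (a + 1) * n := by
    intro i hi
    have h5 : (i + 1) * k ≤ n / k * k := Nat.mul_le_mul_right _ hi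
    constructor <;> nlinarith [Nat.sub_add_cancel hk]
  have hlt : ∀ i, i < n / k → r₀ + i < n := by
    intro i hi
    have h6 := (key i hi).2
    have : (r₀ + i) * k < n * k := by rw [mul_comm n k]; omega
    exact Nat.lt_of_mul_lt_mul_right this
  have := Finset.card_le_card_of_injOn (s := (Finset.univ : Finset (Fin (n / k))))
    (t := Finset.univ.filter fun r : Fin n => (r : ℕ) * k / n = a)
    (fun i => ⟨r₀ + i, hlt i i.2⟩) (fun i _ => by
      simp only [Finset.coe_filter, Finset.mem_univ, true_and, Set.mem_ofPred_eq]
      exact (block_bounds hn _ _).2 (key i i.2)) (fun i _ j _ h => by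
      simp only [Fin.mk.injEq] at h
      exact Fin.ext (by omega))
  simpa using this

theorem card_block_le (hk : 0 < k) (hn : 0 < n) (a : ℕ) :
    (Finset.univ.filter fun r : Fin n => (r : ℕ) * k / n = a).card ≤ n / k + 1 := by
  set r₀ := (a * n + (k - 1)) / k with hr₀
  have h2 : a * n ≤ r₀ * k := by
    have := Nat.lt_div_mul_add (a := a * n + (k - 1)) hk
    rw [← hr₀] at this
    omega
  have key : ∀ r, a * n ≤ r * k → r * k < (a + 1) * n → r ∈ Finset.Icc r₀ (r₀ + n / k) := by
    intro r h3 h4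
    rw [Finset.mem_Icc]
    constructor
    · rw [hr₀]
      apply Nat.le_of_lt_succ
      rw [Nat.div_lt_iff_lt_mul hk]
      have : (r + 1) * k = r * k + k := by ring
      rw [this]
      omega
    · by_contra h
      have h5 : n / k + 1 ≤ r - r₀ := by omega
      have h6 : n < (n / k + 1) * k := by
        have := Nat.lt_div_mul_add (a := n) hk
        linarith
      have h7 : (n / k + 1) * k ≤ (r - r₀) * k := Nat.mul_le_mul_right _ h5
      rw [Nat.sub_mul] at h7
      have : (a + 1) * n = a * n + n := by ring
      omega
  have := Finset.card_le_card_of_injOn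
    (s := Finset.univ.filter fun r : Fin n => (r : ℕ) * k / n = a)
    (t := Finset.Icc r₀ (r₀ + n / k)) (fun r => (r : ℕ)) (fun r hr => by
      simp only [Finset.coe_filter, Finset.mem_univ, true_and, Set.mem_ofPred_eq] at hr
      have := (block_bounds hn _ _).1 hr
      exact key _ this.1 this.2) (fun i _ j _ h => Fin.ext h)
  refine this.trans ?_
  rw [Nat.card_Icc, add_assoc, Nat.add_sub_cancel_left]

/-- The assignment of the vertices to `k` blocks of consecutive latent positions. -/
def rankBlock (hk : 0 < k) (x : Fin n → I) (v : Fin n) : Fin k :=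
  ⟨((Tuple.sort x)⁻¹ v : Fin n) * k / n, by
    have h : (((Tuple.sort x)⁻¹ v : Fin n) : ℕ) < n := Fin.is_lt _
    rw [Nat.div_lt_iff_lt_mul (by omega), mul_comm k]
    exact Nat.mul_lt_mul_of_pos_right h hk⟩

theorem card_rankBlock (hk : 0 < k) (x : Fin n → I) (a : Fin k) :
    (Finset.univ.filter fun v => rankBlock hk x v = a).card
      = (Finset.univ.filter fun r : Fin n => (r : ℕ) * k / n = a).card := by
  refine Finset.card_bij (fun v _ => (Tuple.sort x)⁻¹ v) ?_ ?_ ?_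
  · intro v hv
    simp only [Finset.mem_filter, Finset.mem_univ, true_and, rankBlock, Fin.ext_iff] at hv ⊢
    exact hv
  · intro u _ v _ h
    exact (Tuple.sort x)⁻¹.injective h
  · intro r hr
    refine ⟨Tuple.sort x r, ?_, by simp⟩
    simp only [Finset.mem_filter, Finset.mem_univ, true_and, rankBlock, Fin.ext_iff] at hr ⊢
    simpa using hr

theorem rankBlock_mem_balancedAssignments (hk : 0 < k) (hkn : k ≤ n) (x : Fin n → I) :
    rankBlock hk x ∈ balancedAssignments n k (n / k) := by
  intro a
  have h2 : (rankBlock hk x ⁻¹' {a}) =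
      ((Finset.univ.filter fun v => rankBlock hk x v = a : Finset (Fin n)) : Set (Fin n)) := by
    ext v; simp
  rw [h2, Set.ncard_coe_finset, card_rankBlock]
  exact le_card_block hk hkn a.2

theorem rank_lt_of_lt {x : Fin n → I} {u v : Fin n} (h : x u < x v) :
    (Tuple.sort x)⁻¹ u < (Tuple.sort x)⁻¹ v := by
  by_contra hle
  have := Tuple.monotone_sort x (not_lt.1 hle)
  simp at this
  exact absurd h (not_lt.2 this)

theorem rankBlock_le_of_lt (hk : 0 < k) {x : Fin n → I} {u v : Fin n} (h : x u < x v) :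
    rankBlock hk x u ≤ rankBlock hk x v := by
  have h1 := rank_lt_of_lt h
  rw [Fin.le_def]
  exact Nat.div_le_div_right (Nat.mul_le_mul_right _ h1.le)

theorem rankBlock_eq_of_between (hk : 0 < k) {x : Fin n → I} {u v w : Fin n}
    (huv : rankBlock hk x u = rankBlock hk x v) (h1 : x u < x w) (h2 : x w < x v) :
    rankBlock hk x w = rankBlock hk x u :=
  le_antisymm (huv ▸ rankBlock_le_of_lt hk h2) (rankBlock_le_of_lt hk h1)

/-- Latent positions for which some interval `[l / k, (l + 6) / k]` holds too few of them. -/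
def sparsePositions (n k : ℕ) : Set (Fin n → I) :=
  {x | ∃ l : ℕ, l + 6 ≤ k ∧
    (((Finset.univ.filter fun v => (l : ℝ) / k ≤ x v ∧ (x v : ℝ) ≤ (l + 6) / k).card : ℕ) : ℝ)
      ≤ 2 * (n / k)}

/-- Two positions more than `7 / k` apart have a grid window of length `6 / k` strictly between
them. All its points fall in their common block, which has at most `n / k + 1 ≤ 2 n / k` vertices,
so the window is sparse. Strict betweenness makes the breaking of ties irrelevant. -/
theorem abs_sub_le_of_rankBlock_eq (hk : 0 < k) (hkn : k ≤ n) {x : Fin n → I}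
    (hx : x ∉ sparsePositions n k) {u v : Fin n} (h : rankBlock hk x u = rankBlock hk x v) :
    |(x u : ℝ) - x v| ≤ 7 / k := by
  have hk' : (0 : ℝ) < k := by exact_mod_cast hk
  wlog huv : (x u : ℝ) ≤ x v generalizing u v
  · rw [abs_sub_comm]; exact this h.symm (le_of_not_ge huv)
  by_contra hlt
  rw [abs_of_nonpos (by linarith), not_le, div_lt_iff₀ hk'] at hlt
  set l := ⌊(k : ℝ) * x u⌋₊ + 1 with hl
  have hx0 : 0 ≤ (x u : ℝ) := (x u).2.1
  have hx1 : (x v : ℝ) ≤ 1 := (x v).2.2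
  have hl1 : (l : ℝ) ≤ k * x u + 1 := by
    rw [hl]; push_cast
    have := Nat.floor_le (show 0 ≤ (k : ℝ) * x u by positivity)
    linarith
  have hl2 : (k : ℝ) * x u < l := by
    rw [hl]; push_cast; exact Nat.lt_floor_add_one _
  apply hx
  refine ⟨l, ?_, ?_⟩
  · have : (l : ℝ) + 6 ≤ k := by nlinarith
    exact_mod_cast this
  · have hsub : (Finset.univ.filter fun w => (l : ℝ) / k ≤ x w ∧ (x w : ℝ) ≤ (l + 6) / k) ⊆
        Finset.univ.filter fun w => rankBlock hk x w = rankBlock hk x u := by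
      intro w hw
      simp only [Finset.mem_filter, Finset.mem_univ, true_and] at hw ⊢
      rw [div_le_iff₀ hk', le_div_iff₀ hk'] at hw
      refine rankBlock_eq_of_between hk h ?_ ?_
      · rw [← Subtype.coe_lt_coe]; nlinarith
      · rw [← Subtype.coe_lt_coe]; nlinarith
    have h1 := (Finset.card_le_card hsub).trans
      ((card_rankBlock hk x _).le.trans (card_block_le hk (by omega) _))
    have h2 : ((n / k : ℕ) : ℝ) ≤ n / k := Nat.cast_div_le
    have h3 : (1 : ℝ) ≤ n / k := by
      rw [le_div_iff₀ hk', one_mul]; exact_mod_cast hkn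
    refine (Nat.cast_le (α := ℝ)).2 h1 |>.trans ?_
    push_cast
    linarith

/-- Some block model over the blocks of consecutive latent positions is close to the truth. -/
theorem exists_block_approximation {L : ℝ} {f : (Fin m → I) → I} (hf : IsSLH L f) (hL : 0 ≤ L)
    (ρ : I) (hk : 0 < k) (hkn : k ≤ n) (x : Fin n → I) :
    ∃ Q ∈ blockTensors m k,
      ∑ e : Edge m n, (Q (rankBlock hk x ∘ e.1) - (ρ * f (x ∘ e.1) : I)) ^ 2 ≤
        (n : ℝ) ^ m * (ρ : ℝ) ^ 2 *
          (49 * L ^ 2 / (k : ℝ) ^ 2 + (sparsePositions n k).indicator 1 x) := by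
  have hk' : (0 : ℝ) < k := by exact_mod_cast hk
  have hne : ∀ a : Fin k, ∃ v, rankBlock hk x v = a := by
    intro a
    have h1 := le_card_block hk hkn a.2
    rw [← card_rankBlock hk x a] at h1
    have h2 : 0 < n / k := Nat.div_pos hkn hk
    obtain ⟨v, hv⟩ := Finset.card_pos.1 (h2.trans_le h1)
    exact ⟨v, (Finset.mem_filter.1 hv).2⟩
  -- Evaluating at one representative per block, rather than averaging, makes symmetry and the range
  -- `[0,1]` immediate, also for tuples with repeated blocks.
  choose rep hrep using hne
  refine ⟨fun a => ((ρ * f (x ∘ rep ∘ a) : I) : ℝ),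
    ⟨fun a => (ρ * f (x ∘ rep ∘ a)).2, fun τ a => ?_⟩, ?_⟩
  · have := hf.symmetric τ (x ∘ rep ∘ a)
    change ((ρ * f ((x ∘ rep ∘ a) ∘ τ) : I) : ℝ) = _
    rw [this]
  have key : ∀ e : Edge m n,
      (((ρ * f (x ∘ rep ∘ rankBlock hk x ∘ e.1) : I) : ℝ) - (ρ * f (x ∘ e.1) : I)) ^ 2 ≤
        (ρ : ℝ) ^ 2 * (49 * L ^ 2 / (k : ℝ) ^ 2 + (sparsePositions n k).indicator 1 x) := by
    intro e
    simp only [Set.Icc.coe_mul]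
    rw [← mul_sub, mul_pow]
    refine mul_le_mul_of_nonneg_left ?_ (sq_nonneg _)
    by_cases hx : x ∈ sparsePositions n k
    · rw [Set.indicator_of_mem hx, Pi.one_apply]
      have h1 := (f (x ∘ rep ∘ rankBlock hk x ∘ e.1)).2
      have h2 := (f (x ∘ e.1)).2
      have h3 : ((f (x ∘ rep ∘ rankBlock hk x ∘ e.1) : ℝ) - f (x ∘ e.1)) ^ 2 ≤ 1 := by
        rw [sq_le_one_iff_abs_le_one, abs_le]
        constructor <;> linarith [h1.1, h1.2, h2.1, h2.2]
      have h4 : 0 ≤ 49 * L ^ 2 / (k : ℝ) ^ 2 := by positivity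
      linarith
    · rw [Set.indicator_of_notMem hx, add_zero]
      have h1 := hf.lipschitz (x ∘ rep ∘ rankBlock hk x ∘ e.1) (x ∘ e.1)
      have h2 : dist (x ∘ rep ∘ rankBlock hk x ∘ e.1) (x ∘ e.1) ≤ 7 / k := by
        refine (dist_pi_le_iff (by positivity)).2 fun i => ?_
        rw [Subtype.dist_eq, Real.dist_eq]
        exact abs_sub_le_of_rankBlock_eq hk hkn hx (hrep _)
      have h3 := h1.trans (mul_le_mul_of_nonneg_left h2 hL)
      rw [← sq_abs]
      calc _ ≤ (L * (7 / k)) ^ 2 := by gcongr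
        _ = _ := by ring
  refine (Finset.sum_le_card_nsmul _ _ _ fun e _ => key e).trans ?_
  rw [nsmul_eq_mul, Finset.card_univ, mul_assoc]
  refine mul_le_mul_of_nonneg_right ?_ ?_
  · exact_mod_cast card_edge_le m n
  · refine mul_nonneg (sq_nonneg _) (add_nonneg (by positivity) ?_)
    exact Set.indicator_nonneg (fun _ _ => zero_le_one) _

/-! ### Uniform positions are rarely sparse -/

theorem measurableSet_sparsePositions (n k : ℕ) : MeasurableSet (sparsePositions n k) := by
  have h : sparsePositions n k = ⋃ l : ℕ, {x | l + 6 ≤ k ∧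
      ∑ v, ({y : I | (l : ℝ) / k ≤ y ∧ (y : ℝ) ≤ (l + 6) / k}.indicator 1 (x v) : ℝ)
        ≤ 2 * (n / k)} := by
    ext x
    simp [sparsePositions, Set.indicator_apply]
  rw [h]
  refine MeasurableSet.iUnion fun l => ?_
  by_cases hl : l + 6 ≤ k
  · simp only [hl, true_and]
    refine measurableSet_le (Finset.measurable_sum _ fun v _ => ?_) measurable_const
    have h1 : MeasurableSet {y : I | (l : ℝ) / k ≤ y ∧ (y : ℝ) ≤ (l + 6) / k} :=
      (measurableSet_le measurable_const measurable_subtype_coe).inter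
        (measurableSet_le measurable_subtype_coe measurable_const)
    have h2 : Measurable (Set.indicator {y : I | (l : ℝ) / k ≤ y ∧ (y : ℝ) ≤ (l + 6) / k}
        (1 : I → ℝ)) := measurable_one.indicator h1
    exact h2.comp (measurable_pi_apply v)
  · simp [hl]

/-- Lower-tail Chernoff bound with tilt `-1`: the window has mass `6 / k` and `1 - e⁻¹ ≥ 1/2`, so
the exponential moment is at most `exp (-3 n / k)`, and the threshold costs `exp (2 n / k)`. -/
theorem measureReal_interval_count_le (hk : 0 < k) {l : ℕ} (hl : l + 6 ≤ k) :
    (Measure.pi fun _ : Fin n => (volume : Measure I)).real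
      {x | ∑ v, ({y : I | (l : ℝ) / k ≤ y ∧ (y : ℝ) ≤ (l + 6) / k}.indicator 1 (x v) : ℝ)
        ≤ 2 * (n / k)} ≤ Real.exp (-(n / k)) := by
  have hk' : (0 : ℝ) < k := by exact_mod_cast hk
  have hl' : (l : ℝ) + 6 ≤ k := by exact_mod_cast hl
  set J : Set I := {y : I | (l : ℝ) / k ≤ y ∧ (y : ℝ) ≤ (l + 6) / k} with hJ
  set μ := Measure.pi fun _ : Fin n => (volume : Measure I) with hμ
  have hJm : MeasurableSet J :=
    (measurableSet_le measurable_const measurable_subtype_coe).inter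
      (measurableSet_le measurable_subtype_coe measurable_const)
  have hJvol : (volume : Measure I).real J = 6 / k := by
    have h1 : J = Set.Icc ⟨(l : ℝ) / k, by positivity, by rw [div_le_one hk']; linarith⟩
        ⟨((l : ℝ) + 6) / k, by positivity, by rw [div_le_one hk']; linarith⟩ := by
      ext y; simp [hJ, ← Subtype.coe_le_coe]
    rw [h1, measureReal_def, unitInterval.volume_Icc]
    have h2 : ((l : ℝ) + 6) / k - l / k = 6 / k := by ring
    simp only [h2]
    exact ENNReal.toReal_ofReal (by positivity)
  set g : I → ℝ := fun y => Real.exp (-(J.indicator 1 y)) with hg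
  have hg1 : ∀ y, g y = 1 - (1 - Real.exp (-1)) * J.indicator 1 y := by
    intro y
    by_cases hy : y ∈ J <;> simp [hg, hy]
  have hJint : Integrable (fun y => (1 - Real.exp (-1)) * J.indicator (1 : I → ℝ) y) :=
    ((integrable_const (1 : ℝ)).indicator hJm).const_mul _
  have hgint : ∫ y, g y = 1 - (1 - Real.exp (-1)) * (6 / k) := by
    simp_rw [hg1]
    rw [integral_sub (integrable_const _) hJint, integral_const_mul,
      integral_indicator_one hJm, hJvol]
    simp
  have hgle : ∫ y, g y ≤ Real.exp (-(3 / k)) := by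
    have h1 : Real.exp (-1) ≤ 1 / 2 := by
      rw [Real.exp_neg, inv_le_comm₀ (Real.exp_pos _) (by norm_num)]
      have := Real.add_one_le_exp (1 : ℝ)
      norm_num at this ⊢
      exact this
    have h2 := Real.add_one_le_exp (-(3 / k : ℝ))
    rw [hgint]
    have h3 : (3 / k : ℝ) ≤ (1 - Real.exp (-1)) * (6 / k) := by
      have : (3 / k : ℝ) = 1 / 2 * (6 / k) := by ring
      rw [this]
      gcongr
      linarith
    linarith
  have hprod : ∫ x, ∏ v, g (x v) ∂μ ≤ Real.exp (-(3 * (n / k))) := by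
    rw [hμ, integral_fintype_prod_eq_prod (f := fun _ => g), Finset.prod_const, Finset.card_univ,
      Fintype.card_fin]
    calc (∫ y, g y) ^ n ≤ Real.exp (-(3 / k)) ^ n := by
          refine pow_le_pow_left₀ (integral_nonneg fun y => (Real.exp_pos _).le) hgle n
      _ = _ := by rw [← Real.exp_nat_mul]; ring_nf
  have hint : Integrable (fun x : Fin n → I => ∏ v, g (x v)) μ := by
    refine Integrable.fintype_prod (f := fun _ => g) fun _ => ?_
    simp_rw [funext hg1]
    exact (integrable_const _).sub hJint
  have hmarkov := mul_meas_ge_le_integral_of_nonneg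
    (Filter.Eventually.of_forall fun x => Finset.prod_nonneg fun v _ => (Real.exp_pos _).le) hint
    (Real.exp (-(2 * (n / k))))
  have hsub : {x : Fin n → I | ∑ v, (J.indicator 1 (x v) : ℝ) ≤ 2 * (n / k)} ⊆
      {x | Real.exp (-(2 * (n / k))) ≤ ∏ v, g (x v)} := by
    intro x hx
    simp only [Set.mem_ofPred_eq] at hx ⊢
    simp only [hg]
    rw [← Real.exp_sum, Finset.sum_neg_distrib]
    exact Real.exp_le_exp.2 (neg_le_neg hx)
  have h1 : μ.real {x : Fin n → I | ∑ v, (J.indicator 1 (x v) : ℝ) ≤ 2 * (n / k)} ≤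
      μ.real {x | Real.exp (-(2 * (n / k))) ≤ ∏ v, g (x v)} :=
    measureReal_mono hsub (measure_ne_top _ _)
  have h2 : Real.exp (-(2 * (n / k) : ℝ)) * μ.real
      {x : Fin n → I | ∑ v, (J.indicator 1 (x v) : ℝ) ≤ 2 * (n / k)}
      ≤ Real.exp (-(2 * (n / k))) * Real.exp (-(n / k)) := by
    rw [← Real.exp_add]
    refine ((mul_le_mul_of_nonneg_left h1 (Real.exp_pos _).le).trans hmarkov).trans
      (hprod.trans (le_of_eq ?_))
    ring_nf
  exact le_of_mul_le_mul_left h2 (Real.exp_pos _)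

theorem measureReal_sparsePositions_le (hk : 0 < k) :
    (Measure.pi fun _ : Fin n => (volume : Measure I)).real (sparsePositions n k) ≤
      k * Real.exp (-(n / k)) := by
  have h : sparsePositions n k ⊆ ⋃ l ∈ (Finset.range k).filter fun l => l + 6 ≤ k, {x |
      ∑ v, ({y : I | (l : ℝ) / k ≤ y ∧ (y : ℝ) ≤ (l + 6) / k}.indicator 1 (x v) : ℝ)
        ≤ 2 * (n / k)} := by
    rintro x ⟨l, hl, hx⟩
    simp only [Set.mem_iUnion, Finset.mem_filter, Finset.mem_range]
    exact ⟨l, ⟨by omega, hl⟩, by simpa [Set.indicator_apply] using hx⟩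
  refine (measureReal_mono h (measure_ne_top _ _)).trans
    ((measureReal_biUnion_finset_le _ _).trans ?_)
  refine (Finset.sum_le_card_nsmul _ _ (Real.exp (-(n / k))) fun l hl => ?_).trans ?_
  · exact measureReal_interval_count_le hk (Finset.mem_filter.1 hl).2
  · rw [nsmul_eq_mul]
    refine mul_le_mul_of_nonneg_right ?_ (Real.exp_pos _).le
    exact_mod_cast (Finset.card_filter_le _ _).trans (Finset.card_range k).le

/-! ### The integrated risk -/

theorem blockModel_mem {Q : Tensor m k} (hQ : Q ∈ blockTensors m k) (z : Fin n → Fin k)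
    (j : Fin m → Fin n) : blockModel z Q j ∈ Set.Icc (0 : ℝ) 1 := by
  unfold blockModel
  split_ifs
  · exact hQ.1 _
  · simp

theorem trueTensor_mem (ρ : I) (f : (Fin m → I) → I) (x : Fin n → I) (j : Fin m → Fin n) :
    trueTensor ρ f x j ∈ Set.Icc (0 : ℝ) 1 := by
  unfold trueTensor
  split_ifs
  · have := (ρ * f (x ∘ j)).2
    simpa using this
  · simp

theorem frobeniusSq_sub_le_one {Q : Tensor m k} (hQ : Q ∈ blockTensors m k) (z : Fin n → Fin k)
    (ρ : I) (f : (Fin m → I) → I) (x : Fin n → I) :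
    1 / (n : ℝ) ^ m * frobeniusSq (blockModel z Q - trueTensor ρ f x) ≤ 1 := by
  have h : frobeniusSq (blockModel z Q - trueTensor ρ f x) ≤ (n : ℝ) ^ m := by
    have : ∑ j, (blockModel z Q - trueTensor ρ f x) j ^ 2 ≤ ∑ _j : Fin m → Fin n, (1 : ℝ) := by
      refine Finset.sum_le_sum fun j _ => ?_
      have h1 := blockModel_mem hQ z j
      have h2 := trueTensor_mem ρ f x j
      rw [Pi.sub_apply, sq_le_one_iff_abs_le_one, abs_le]
      constructor <;> linarith [h1.1, h1.2, h2.1, h2.2]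
    simpa [frobeniusSq] using this
  rw [one_div, inv_mul_eq_div]
  exact div_le_one_of_le₀ h (by positivity)

theorem frobeniusSq_nonneg (T : Tensor m n) : 0 ≤ frobeniusSq T :=
  Finset.sum_nonneg fun _ _ => sq_nonneg _

theorem measurable_trueTensor {f : (Fin m → I) → I} (hf : Measurable f) (ρ : I)
    (j : Fin m → Fin n) : Measurable fun x : Fin n → I => trueTensor ρ f x j := by
  unfold trueTensor
  split_ifs
  · refine measurable_const.mul (measurable_subtype_coe.comp (hf.comp ?_))
    exact measurable_pi_lambda _ fun i => measurable_pi_apply (j i)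
  · exact measurable_const

theorem integrable_loss {f : (Fin m → I) → I} (hf : Measurable f) (ρ : I)
    (zhat : Hypergraph m n → Fin n → Fin k) {Qhat : Hypergraph m n → Tensor m k}
    (hQ : ∀ G, Qhat G ∈ blockTensors m k) :
    Integrable (fun p : (Fin n → I) × Hypergraph m n =>
      1 / (n : ℝ) ^ m * frobeniusSq (blockModel (zhat p.2) (Qhat p.2) - trueTensor ρ f p.1))
      (sampleLaw n ρ f hf) := by
  refine Integrable.of_bound (C := 1) (Measurable.aestronglyMeasurable ?_)
    (Filter.Eventually.of_forall fun p => ?_)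
  -- There are finitely many hypergraphs, so an arbitrary choice of minimizer is measurable.
  · refine measurable_from_prod_countable_left fun G => ?_
    refine measurable_const.mul (Finset.measurable_sum _ fun j _ => ?_)
    change Measurable fun x => (blockModel (zhat G) (Qhat G) j - trueTensor ρ f x j) ^ 2
    exact ((measurable_trueTensor hf ρ j).const_sub _).pow_const 2
  · rw [Real.norm_of_nonneg (mul_nonneg (by positivity) (frobeniusSq_nonneg _))]
    exact frobeniusSq_sub_le_one (hQ p.2) _ ρ f p.1

theorem integral_loss_le_one {f : (Fin m → I) → I} (hf : Measurable f) (ρ : I)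
    (zhat : Hypergraph m n → Fin n → Fin k) {Qhat : Hypergraph m n → Tensor m k}
    (hQ : ∀ G, Qhat G ∈ blockTensors m k) :
    ∫ p, 1 / (n : ℝ) ^ m * frobeniusSq (blockModel (zhat p.2) (Qhat p.2) - trueTensor ρ f p.1)
      ∂sampleLaw n ρ f hf ≤ 1 := by
  have := integral_mono (integrable_loss hf ρ zhat hQ) (integrable_const (1 : ℝ))
    fun p => frobeniusSq_sub_le_one (hQ p.2) (zhat p.2) ρ f p.1
  simpa using this

theorem integral_loss_le {L : ℝ} (hL : 0 ≤ L) {f : (Fin m → I) → I} (hf : IsSLH L f) {ρ : I}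
    (hρ : 0 < (ρ : ℝ)) (hm : 1 ≤ m) (hk : 0 < k) (hkn : k ≤ n) (hn₀ : 2 * m ≤ n / k)
    (H : 2 * (m.factorial * 2 ^ m * m) * Real.log n ≤ ρ * ((n / k : ℕ) : ℝ) ^ (m - 1))
    {zhat : Hypergraph m n → Fin n → Fin k} {Qhat : Hypergraph m n → Tensor m k}
    (hls : ∀ G, IsLeastSquares (n / k) (adjacency G) (zhat G) (Qhat G)) :
    ∫ p, 1 / (n : ℝ) ^ m * frobeniusSq (blockModel (zhat p.2) (Qhat p.2) - trueTensor ρ f p.1)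
      ∂sampleLaw n ρ f hf.measurable ≤
    m.factorial * (2 * (ρ : ℝ) ^ 2 *
        (49 * L ^ 2 / (k : ℝ) ^ 2 + k * Real.exp (-((n : ℝ) / k)))
      + (160 * ρ * (n * Real.log k) + 128 * ρ * (k ^ m * Real.log tiltConst)
        + 8 * Real.exp m) / (n : ℝ) ^ m) := by
  have hn : 1 ≤ n := by omega
  have hn' : (0 : ℝ) < n := by exact_mod_cast hn
  have hint := integrable_loss hf.measurable ρ zhat fun G => (hls G).tensor_mem
  set V : ℝ := 160 * ρ * (n * Real.log k) + 128 * ρ * (k ^ m * Real.log tiltConst)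
    + 8 * Real.exp m with hV
  set μ := Measure.pi fun _ : Fin n => (volume : Measure I) with hμ
  have hbound : ∀ x : Fin n → I, ∫ G, 1 / (n : ℝ) ^ m *
      frobeniusSq (blockModel (zhat G) (Qhat G) - trueTensor ρ f x) ∂edgeLaw ρ f x ≤
      m.factorial * (2 * (ρ : ℝ) ^ 2 * (49 * L ^ 2 / (k : ℝ) ^ 2
        + (sparsePositions n k).indicator 1 x) + V / (n : ℝ) ^ m) := by
    intro x
    obtain ⟨Qs, hQs, happrox⟩ := exists_block_approximation hf hL ρ hk hkn x
    have h1 := integral_frobeniusSq_le hf hρ hn hm hn₀ H hls x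
      (rankBlock_mem_balancedAssignments hk hkn x) hQs
    rw [integral_const_mul, one_div, inv_mul_eq_div, div_le_iff₀ (by positivity)]
    refine h1.trans ?_
    rw [mul_assoc (m.factorial : ℝ)]
    refine mul_le_mul_of_nonneg_left ?_ (Nat.cast_nonneg _)
    rw [add_mul, div_mul_cancel₀ V (by positivity)]
    linarith
  have hind : Integrable ((sparsePositions n k).indicator (1 : (Fin n → I) → ℝ)) μ :=
    (integrable_const (1 : ℝ)).indicator (measurableSet_sparsePositions n k)
  have h2 : ∫ p, 1 / (n : ℝ) ^ m *
      frobeniusSq (blockModel (zhat p.2) (Qhat p.2) - trueTensor ρ f p.1)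
      ∂sampleLaw n ρ f hf.measurable = ∫ x, ∫ G, 1 / (n : ℝ) ^ m *
      frobeniusSq (blockModel (zhat G) (Qhat G) - trueTensor ρ f x) ∂edgeLaw ρ f x ∂μ :=
    Measure.integral_compProd hint
  have h3 : Integrable (fun x => 49 * L ^ 2 / (k : ℝ) ^ 2
      + (sparsePositions n k).indicator (1 : (Fin n → I) → ℝ) x) μ :=
    (integrable_const _).add hind
  rw [h2]
  calc _ ≤ ∫ x, m.factorial * (2 * (ρ : ℝ) ^ 2 * (49 * L ^ 2 / (k : ℝ) ^ 2
        + (sparsePositions n k).indicator (1 : (Fin n → I) → ℝ) x) + V / (n : ℝ) ^ m) ∂μ :=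
        integral_mono_of_nonneg
          (Filter.Eventually.of_forall fun x => integral_nonneg fun G =>
            mul_nonneg (by positivity) (frobeniusSq_nonneg _))
          (((h3.const_mul _).add (integrable_const _)).const_mul _)
          (Filter.Eventually.of_forall hbound)
    _ = m.factorial * (2 * (ρ : ℝ) ^ 2 * (49 * L ^ 2 / (k : ℝ) ^ 2
        + μ.real (sparsePositions n k)) + V / (n : ℝ) ^ m) := by
        rw [integral_const_mul, integral_add (h3.const_mul _) (integrable_const _),
          integral_const_mul, integral_add (integrable_const _) hind,
          integral_indicator_one (measurableSet_sparsePositions n k)]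
        simp
    _ ≤ _ := by
        have := measureReal_sparsePositions_le (n := n) hk
        gcongr

/-! ### The resolution `(ρ n ^ m) ^ (1 / (m + 2))` -/

/-- The number of blocks of the estimator, before rounding. -/
def resolution (m n : ℕ) (ρ : ℝ) : ℝ := (ρ * (n : ℝ) ^ m) ^ (1 / ((m : ℝ) + 2))

theorem resolution_nonneg (m n : ℕ) {ρ : ℝ} (hρ : 0 ≤ ρ) : 0 ≤ resolution m n ρ := by
  unfold resolution; positivity

theorem resolution_pow (m n : ℕ) {ρ : ℝ} (hρ : 0 ≤ ρ) :
    resolution m n ρ ^ (m + 2) = ρ * (n : ℝ) ^ m := by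
  unfold resolution
  have := Real.rpow_inv_natCast_pow (x := ρ * (n : ℝ) ^ m) (by positivity)
    (n := m + 2) (by omega)
  rw [one_div]
  exact_mod_cast this

/-- The first term of the rate is the squared bias `ρ² / κ²` at the resolution `κ`; by
`resolution_pow` it is also the variance `ρ κ ^ m / n ^ m`. -/
theorem rate_mul_resolution_sq (m : ℕ) {n : ℕ} (hn : 1 ≤ n) {ρ : ℝ} (hρ : 0 < ρ) :
    ρ ^ ((2 * (m : ℝ) + 2) / ((m : ℝ) + 2)) * (n : ℝ) ^ (-(2 * (m : ℝ) / ((m : ℝ) + 2)))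
      * resolution m n ρ ^ 2 = ρ ^ 2 := by
  have hn' : (0 : ℝ) < n := by exact_mod_cast hn
  have h1 : resolution m n ρ ^ 2
      = ρ ^ (2 / ((m : ℝ) + 2)) * (n : ℝ) ^ (2 * (m : ℝ) / ((m : ℝ) + 2)) := by
    unfold resolution
    rw [← Real.rpow_natCast, ← Real.rpow_mul (by positivity),
      Real.mul_rpow hρ.le (by positivity), ← Real.rpow_natCast (n : ℝ) m,
      ← Real.rpow_mul hn'.le]
    congr 2
    · push_cast; ring
    · push_cast; ring
  rw [h1]
  calc _ = (ρ ^ ((2 * (m : ℝ) + 2) / ((m : ℝ) + 2)) * ρ ^ (2 / ((m : ℝ) + 2))) *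
        ((n : ℝ) ^ (-(2 * (m : ℝ) / ((m : ℝ) + 2))) * (n : ℝ) ^ (2 * (m : ℝ) / ((m : ℝ) + 2))) := by
        ring
    _ = ρ ^ 2 := by
        rw [← Real.rpow_add hρ, ← Real.rpow_add hn', neg_add_cancel, Real.rpow_zero, mul_one,
          ← add_div, ← Real.rpow_natCast]
        congr 1
        have : (m : ℝ) + 2 ≠ 0 := by positivity
        field_simp
        push_cast
        ring

theorem inv_le_of_density {n : ℕ} (hm : 2 ≤ m) (hn : 1 ≤ n) {ρ : ℝ} (hlog : 1 ≤ Real.log n)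
    (h : Real.log n ^ 2 * (n : ℝ) ^ (-(2 / ((m : ℝ) + 1))) ≤ ρ) : (n : ℝ)⁻¹ ≤ ρ := by
  have hn' : (1 : ℝ) ≤ n := by exact_mod_cast hn
  have hm' : (2 : ℝ) ≤ m := by exact_mod_cast hm
  have h1 : (n : ℝ)⁻¹ ≤ (n : ℝ) ^ (-(2 / ((m : ℝ) + 1))) := by
    rw [← Real.rpow_neg_one]
    apply Real.rpow_le_rpow_of_exponent_le hn'
    rw [neg_le_neg_iff, div_le_one (by positivity)]
    linarith
  have h2 : (1 : ℝ) ≤ Real.log n ^ 2 := one_le_pow₀ hlog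
  have h3 : 0 ≤ (n : ℝ) ^ (-(2 / ((m : ℝ) + 1))) := by positivity
  nlinarith

/-- This is the condition `ρ n₀ ^ (m - 1) ≳ log n` rewritten for `n₀ ≍ n / κ`. The critical case is
`m = 2`; for `m ≥ 3` the density assumption gives `ρ ≥ n ^ (-1/2)` and there is polynomial room. -/
theorem le_resolution_cube {n : ℕ} (hm : 2 ≤ m) (hn : 1 ≤ n) {ρ D : ℝ} (hD : 1 ≤ D)
    (hlog : D ^ 2 ≤ Real.log n) (hsqrt : D * Real.log n ≤ √n)
    (h : Real.log n ^ 2 * (n : ℝ) ^ (-(2 / ((m : ℝ) + 1))) ≤ ρ) :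
    D * (n * Real.log n) ≤ resolution m n ρ ^ 3 := by
  have hn' : (1 : ℝ) ≤ n := by exact_mod_cast hn
  have hn0 : (0 : ℝ) < n := by linarith
  have hlog1 : 1 ≤ Real.log n := (one_le_pow₀ hD).trans hlog
  have hρ : 0 ≤ ρ := le_trans (by positivity) h
  have hκ := resolution_nonneg m n hρ
  have hpow := resolution_pow m n hρ
  set κ := resolution m n ρ with hκdef
  rcases hm.eq_or_lt with hm2 | hm3
  · subst hm2
    set t : ℝ := (n : ℝ) ^ (1 / 3 : ℝ) with ht
    have ht0 : 0 < t := Real.rpow_pos_of_pos hn0 _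
    have ht3 : t ^ 3 = n := by
      rw [ht, ← Real.rpow_natCast, ← Real.rpow_mul hn0.le]; norm_num
    have h1 : Real.log n ^ 2 * t ^ 4 ≤ κ ^ 4 := by
      have h2 : (n : ℝ) ^ (-(2 / (((2 : ℕ) : ℝ) + 1))) * (n : ℝ) ^ 2 = t ^ 4 := by
        rw [ht, ← Real.rpow_natCast, ← Real.rpow_natCast, ← Real.rpow_mul hn0.le,
          ← Real.rpow_add hn0]
        norm_num
      have h3 := mul_le_mul_of_nonneg_right h (by positivity : (0 : ℝ) ≤ (n : ℝ) ^ 2)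
      rw [mul_assoc, h2, ← hpow] at h3
      exact h3
    -- In units of `t = n ^ (1/3)` the density assumption says `log n ≤ w²`. The spare factor `w ≥
    -- √(log n) ≥ D` absorbs the constant.
    set w := κ / t with hw
    have hw0 : 0 ≤ w := by positivity
    have hκw : κ = w * t := by rw [hw]; field_simp
    have h4 : Real.log n ≤ w ^ 2 := by
      rw [hκw, mul_pow] at h1
      have h5 := le_of_mul_le_mul_right h1 (by positivity)
      have : Real.log n ^ 2 ≤ (w ^ 2) ^ 2 := by linarith [show (w ^ 2) ^ 2 = w ^ 4 by ring]
      exact le_of_sq_le_sq this (by positivity)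
    have h6 : D ≤ w := le_of_sq_le_sq (hlog.trans h4) hw0
    have h7 : D * Real.log n ≤ w ^ 3 := by
      calc D * Real.log n ≤ w * w ^ 2 := by gcongr
        _ = w ^ 3 := by ring
    rw [hκw, mul_pow, ht3]
    nlinarith
  · have hs0 : 0 < √(n : ℝ) := Real.sqrt_pos.2 hn0
    have hs1 : 1 ≤ √(n : ℝ) := Real.one_le_sqrt.2 hn'
    have hss : √(n : ℝ) ^ 2 = n := Real.sq_sqrt hn0.le
    have hm' : (3 : ℝ) ≤ m := by exact_mod_cast hm3
    have h1 : (√(n : ℝ))⁻¹ ≤ ρ := by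
      have h2 : (√(n : ℝ))⁻¹ ≤ (n : ℝ) ^ (-(2 / ((m : ℝ) + 1))) := by
        rw [Real.sqrt_eq_rpow, ← Real.rpow_neg hn0.le]
        apply Real.rpow_le_rpow_of_exponent_le hn'
        rw [neg_le_neg_iff, div_le_div_iff₀ (by positivity) (by norm_num)]
        linarith
      have h3 : (1 : ℝ) ≤ Real.log n ^ 2 := one_le_pow₀ hlog1
      have h4 : 0 ≤ (n : ℝ) ^ (-(2 / ((m : ℝ) + 1))) := by positivity
      nlinarith
    have h2 : √(n : ℝ) ^ (m + 2) ≤ κ ^ (m + 2) := by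
      rw [hpow]
      -- The exponents compare exactly when `m ≥ 3`.
      calc √(n : ℝ) ^ (m + 2) ≤ √(n : ℝ) ^ (2 * m - 1) := pow_le_pow_right₀ hs1 (by omega)
        _ = (√(n : ℝ))⁻¹ * (n : ℝ) ^ m := by
            rw [eq_inv_mul_iff_mul_eq₀ hs0.ne', ← pow_succ', show 2 * m - 1 + 1 = 2 * m by omega,
              pow_mul, hss]
        _ ≤ ρ * (n : ℝ) ^ m := by gcongr
    have h3 : √(n : ℝ) ≤ κ := le_of_pow_le_pow_left₀ (by omega) hκ h2
    calc D * (n * Real.log n) = (D * Real.log n) * √(n : ℝ) ^ 2 := by rw [hss]; ring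
      _ ≤ √(n : ℝ) * √(n : ℝ) ^ 2 := by gcongr
      _ = √(n : ℝ) ^ 3 := by ring
      _ ≤ κ ^ 3 := by gcongr

theorem le_div_resolution {n M : ℕ} (hn : M ^ (m + 2) ≤ n) (hn1 : 1 ≤ n) {ρ : ℝ} (hρ : 0 ≤ ρ)
    (hρ1 : ρ ≤ 1) : M * resolution m n ρ ≤ n := by
  have hn' : (1 : ℝ) ≤ n := by exact_mod_cast hn1
  refine le_of_pow_le_pow_left₀ (n := m + 2) (by omega) (by positivity) ?_
  rw [mul_pow, resolution_pow m n hρ]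
  have h1 : (M : ℝ) ^ (m + 2) ≤ n := by exact_mod_cast hn
  calc (M : ℝ) ^ (m + 2) * (ρ * (n : ℝ) ^ m) ≤ n * (1 * (n : ℝ) ^ m) := by gcongr
    _ = (n : ℝ) ^ (m + 1) := by ring
    _ ≤ (n : ℝ) ^ (m + 2) := pow_le_pow_right₀ hn' (by omega)

/-- As `k ^ (m + 2) ≲ n ^ m`, the ratio `n / k` is at least of order `n ^ (2 / (m + 2))`. The Taylor
term of degree `q = 2 (m + 2)` is then of order `n ^ 4`, which exceeds `k ^ 3`. -/
theorem exp_neg_div_le {n k : ℕ} (hn1 : 1 ≤ n) (hk : 0 < k) (hkn : k ≤ n) {ρ : ℝ} (hρ : 0 ≤ ρ)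
    (hρ1 : ρ ≤ 1) (hk2 : (k : ℝ) ≤ 2 * resolution m n ρ) :
    k * Real.exp (-((n : ℝ) / k)) ≤
      (2 * (m + 2)).factorial * 2 ^ (2 * (m + 2)) / (k : ℝ) ^ 2 := by
  have hk' : (0 : ℝ) < k := by exact_mod_cast hk
  have hkn' : (k : ℝ) ≤ n := by exact_mod_cast hkn
  have hn' : (1 : ℝ) ≤ n := by exact_mod_cast hn1
  set q := 2 * (m + 2) with hq
  have h1 : ((n : ℝ) / k) ^ q / q.factorial ≤ Real.exp ((n : ℝ) / k) :=
    Real.pow_div_factorial_le_exp _ (by positivity) q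
  have h2 : (k : ℝ) ^ (m + 2) ≤ 2 ^ (m + 2) * (n : ℝ) ^ m := by
    calc (k : ℝ) ^ (m + 2) ≤ (2 * resolution m n ρ) ^ (m + 2) := by gcongr
      _ = 2 ^ (m + 2) * (ρ * (n : ℝ) ^ m) := by rw [mul_pow, resolution_pow m n hρ]
      _ ≤ 2 ^ (m + 2) * (1 * (n : ℝ) ^ m) := by gcongr
      _ = _ := by ring
  have h3 : (n : ℝ) ^ 2 ≤ 2 ^ (m + 2) * ((n : ℝ) / k) ^ (m + 2) := by
    rw [div_pow, mul_div_assoc', le_div_iff₀ (by positivity)]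
    calc (n : ℝ) ^ 2 * (k : ℝ) ^ (m + 2) ≤ (n : ℝ) ^ 2 * (2 ^ (m + 2) * (n : ℝ) ^ m) := by gcongr
      _ = _ := by ring
  have h4 : (n : ℝ) ^ 4 ≤ 2 ^ q * ((n : ℝ) / k) ^ q := by
    calc (n : ℝ) ^ 4 = ((n : ℝ) ^ 2) ^ 2 := by ring
      _ ≤ (2 ^ (m + 2) * ((n : ℝ) / k) ^ (m + 2)) ^ 2 := by gcongr
      _ = _ := by rw [hq]; ring
  have h5 : (k : ℝ) ^ 3 ≤ 2 ^ q * q.factorial * Real.exp ((n : ℝ) / k) := by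
    rw [div_le_iff₀ (by positivity)] at h1
    calc (k : ℝ) ^ 3 ≤ (n : ℝ) ^ 3 := by gcongr
      _ ≤ (n : ℝ) ^ 4 := pow_le_pow_right₀ hn' (by norm_num)
      _ ≤ 2 ^ q * ((n : ℝ) / k) ^ q := h4
      _ ≤ 2 ^ q * (Real.exp ((n : ℝ) / k) * q.factorial) := by gcongr
      _ = _ := by ring
  rw [le_div_iff₀ (by positivity), Real.exp_neg, mul_comm (k : ℝ), mul_assoc, ← pow_succ',
    inv_mul_le_iff₀ (Real.exp_pos _)]
  linarith

/-! ### The rate of convergence -/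

/-- The constant in the balancing condition between the block volume and the entropy of blocks. -/
def balanceConst (m : ℕ) : ℝ := 2 * (m.factorial * 2 ^ m * m)

/-- The constant in the risk bound for large `n`. -/
def riskConst (m : ℕ) (L : ℝ) : ℝ :=
  m.factorial * (98 * L ^ 2 + 2 * ((2 * (m + 2)).factorial * 2 ^ (2 * (m + 2))) + 160
    + 128 * 2 ^ m * |Real.log tiltConst| + 8 * Real.exp m)

theorem one_le_balanceConst (hm : 1 ≤ m) : 1 ≤ balanceConst m := by
  have h1 : 1 ≤ 2 * (m.factorial * 2 ^ m * m) :=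
    Nat.one_le_iff_ne_zero.2 (by positivity)
  unfold balanceConst
  exact_mod_cast h1

theorem riskConst_nonneg (m : ℕ) (L : ℝ) : 0 ≤ riskConst m L := by
  unfold riskConst; positivity

/-- The sample sizes beyond which the asymptotic regime is reached. -/
theorem exists_large (a b c : ℝ) : ∃ N : ℕ, ∀ n : ℕ, N ≤ n →
    a ≤ n ∧ b ≤ Real.log n ∧ c * Real.log n ≤ √n := by
  have h1 : ∀ᶠ x : ℝ in Filter.atTop, a ≤ x := Filter.eventually_ge_atTop a
  have h2 : ∀ᶠ x : ℝ in Filter.atTop, b ≤ Real.log x :=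
    Real.tendsto_log_atTop.eventually_ge_atTop b
  have h3 : ∀ᶠ x : ℝ in Filter.atTop, c * Real.log x ≤ √x := by
    have h4 := (isLittleO_log_rpow_atTop (r := 1 / 2) (by norm_num)).const_mul_left c
    filter_upwards [h4.bound one_pos, Filter.eventually_ge_atTop 0] with x hx hx0
    rw [one_mul, Real.norm_eq_abs, Real.norm_eq_abs, ← Real.sqrt_eq_rpow,
      abs_of_nonneg (Real.sqrt_nonneg x)] at hx
    exact (le_abs_self _).trans hx
  exact Filter.eventually_atTop.1
    (tendsto_natCast_atTop_atTop.eventually (h1.and (h2.and h3)))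

set_option maxHeartbeats 800000 in
theorem integral_loss_le_rate {L : ℝ} (hL : 0 ≤ L) {f : (Fin m → I) → I} (hf : IsSLH L f)
    (hm : 2 ≤ m) (hn : 1 ≤ n) {ρ : I} (hρ : 0 < (ρ : ℝ))
    (hdens : Real.log n ^ 2 * (n : ℝ) ^ (-(2 / ((m : ℝ) + 1))) ≤ ρ)
    (hlarge : (4 * (m + 1)) ^ (m + 2) ≤ n)
    (hlog : (balanceConst m * 4 ^ (m - 1)) ^ 2 ≤ Real.log n)
    (hsqrt : balanceConst m * 4 ^ (m - 1) * Real.log n ≤ √n)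
    (hk : k = ⌈resolution m n ρ⌉₊)
    {zhat : Hypergraph m n → Fin n → Fin k} {Qhat : Hypergraph m n → Tensor m k}
    (hls : ∀ G, IsLeastSquares (n / k) (adjacency G) (zhat G) (Qhat G)) :
    ∫ p, 1 / (n : ℝ) ^ m * frobeniusSq (blockModel (zhat p.2) (Qhat p.2) - trueTensor ρ f p.1)
      ∂sampleLaw n ρ f hf.measurable ≤
    riskConst m L * ((ρ : ℝ) ^ ((2 * (m : ℝ) + 2) / ((m : ℝ) + 2)) *
        (n : ℝ) ^ (-(2 * (m : ℝ) / ((m : ℝ) + 2))) + ρ * (Real.log n / (n : ℝ) ^ (m - 1))) := by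
  have hn' : (1 : ℝ) ≤ n := by exact_mod_cast hn
  have hn0 : (0 : ℝ) < n := by linarith
  have hE := one_le_balanceConst (m := m) (by omega)
  have hD : 1 ≤ balanceConst m * 4 ^ (m - 1) := by
    have : (1 : ℝ) ≤ 4 ^ (m - 1) := one_le_pow₀ (by norm_num)
    nlinarith
  have hlog1 : 1 ≤ Real.log n := (one_le_pow₀ hD).trans hlog
  have hinv := inv_le_of_density hm hn hlog1 hdens
  have hρn : 1 ≤ (ρ : ℝ) * n := by
    rwa [inv_le_iff_one_le_mul₀ hn0] at hinv
  have hκ0 := resolution_nonneg m n hρ.le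
  have hpow := resolution_pow m n hρ.le
  have hcube := le_resolution_cube hm hn hD hlog hsqrt hdens
  have hdiv := le_div_resolution (m := m) hlarge hn hρ.le ρ.2.2
  have hrate := rate_mul_resolution_sq m hn hρ
  set R := (ρ : ℝ) ^ ((2 * (m : ℝ) + 2) / ((m : ℝ) + 2)) *
        (n : ℝ) ^ (-(2 * (m : ℝ) / ((m : ℝ) + 2))) with hR
  have hR0 : 0 ≤ R := by positivity
  set κ := resolution m n ρ with hκdef
  have hκ1 : 1 ≤ κ := by
    have h1 : 1 ≤ κ ^ (m + 2) := by
      rw [hpow]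
      calc 1 ≤ (ρ : ℝ) * n := hρn
        _ ≤ (ρ : ℝ) * (n : ℝ) ^ m := by
          gcongr; exact le_self_pow₀ hn' (by omega)
    by_contra hlt
    exact absurd h1 (not_le.2 (pow_lt_one₀ hκ0 (not_le.1 hlt) (by omega)))
  have hκk : κ ≤ k := by rw [hk]; exact Nat.le_ceil _
  have hk2 : (k : ℝ) ≤ 2 * κ := by
    have := Nat.ceil_lt_add_one hκ0
    rw [← hk] at this
    linarith
  have hk0 : (0 : ℝ) < k := by linarith
  have hkpos : 0 < k := by exact_mod_cast hk0
  have hMk : 2 * (m + 1) * k ≤ n := by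
    have : (2 * (m + 1) * k : ℝ) ≤ n := by
      push_cast at hdiv
      nlinarith
    exact_mod_cast this
  have hkn : k ≤ n := by nlinarith
  have hn₀ : 2 * m ≤ n / k := by
    rw [Nat.le_div_iff_mul_le hkpos]; nlinarith
  have hH : 2 * (m.factorial * 2 ^ m * m) * Real.log n ≤ ρ * ((n / k : ℕ) : ℝ) ^ (m - 1) := by
    -- One factor 2 is for rounding `κ` up to `k`, the other for rounding `n / k` down.
    have h1 : (n : ℝ) / (4 * κ) ≤ ((n / k : ℕ) : ℝ) := by
      have h2 : (n : ℝ) < ((n / k : ℕ) + 1) * k := by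
        have := Nat.lt_div_mul_add (a := n) hkpos
        have h3 : n < (n / k + 1) * k := by linarith
        exact_mod_cast h3
      have h3 : (1 : ℝ) ≤ ((n / k : ℕ) : ℝ) := by
        exact_mod_cast (by omega : 1 ≤ n / k)
      rw [div_le_iff₀ (by positivity)]
      nlinarith
    have h2 : balanceConst m * Real.log n ≤ ρ * ((n : ℝ) / (4 * κ)) ^ (m - 1) := by
      rw [div_pow, mul_div_assoc', le_div_iff₀ (by positivity)]
      refine le_of_mul_le_mul_right ?_ hn0
      have hm1 : m - 1 + 1 = m := by omega
      calc balanceConst m * Real.log n * (4 * κ) ^ (m - 1) * n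
          = balanceConst m * 4 ^ (m - 1) * (n * Real.log n) * κ ^ (m - 1) := by
            rw [mul_pow]; ring
        _ ≤ κ ^ 3 * κ ^ (m - 1) := by gcongr
        _ = κ ^ (m + 2) := by rw [← pow_add]; congr 1; omega
        _ = ρ * ((n : ℝ) ^ (m - 1) * n) := by rw [hpow, ← pow_succ, hm1]
        _ = _ := by ring
    refine h2.trans ?_
    gcongr
  refine (integral_loss_le hL hf hρ (by omega) hkpos hkn hn₀ hH hls).trans ?_
  have hlog0 : 0 ≤ Real.log n := by linarith
  set R' := (ρ : ℝ) * (Real.log n / (n : ℝ) ^ (m - 1)) with hR'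
  have hR'0 : 0 ≤ R' := by positivity
  have hnm : (n : ℝ) ^ m = (n : ℝ) ^ (m - 1) * n := by
    rw [← pow_succ]; congr 1; omega
  have t1 : (ρ : ℝ) ^ 2 / (k : ℝ) ^ 2 ≤ R := by
    rw [div_le_iff₀ (by positivity)]
    calc (ρ : ℝ) ^ 2 = R * κ ^ 2 := hrate.symm
      _ ≤ R * (k : ℝ) ^ 2 := mul_le_mul_of_nonneg_left (pow_le_pow_left₀ hκ0 hκk 2) hR0
  have t2 := exp_neg_div_le hn hkpos hkn hρ.le ρ.2.2 hk2
  set F : ℝ := (2 * (m + 2)).factorial * 2 ^ (2 * (m + 2)) with hF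
  have hF0 : 0 ≤ F := by positivity
  have t3 : (ρ : ℝ) * (n * Real.log k) / (n : ℝ) ^ m ≤ R' := by
    have h1 : Real.log k ≤ Real.log n :=
      Real.log_le_log hk0 (by exact_mod_cast hkn)
    have h2 : (ρ : ℝ) * (n * Real.log k) / (n : ℝ) ^ m
        = ρ * (Real.log k / (n : ℝ) ^ (m - 1)) := by
      rw [hnm]; field_simp
    rw [h2, hR']
    gcongr
  have t4 : (ρ : ℝ) * (k ^ m * Real.log tiltConst) / (n : ℝ) ^ m
      ≤ 2 ^ m * |Real.log tiltConst| * R := by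
    have h1 : (ρ : ℝ) * κ ^ m ≤ R * (n : ℝ) ^ m := by
      refine le_of_mul_le_mul_right (le_of_eq ?_) (by positivity : 0 < κ ^ 2)
      calc (ρ : ℝ) * κ ^ m * κ ^ 2 = ρ * κ ^ (m + 2) := by ring
        _ = (ρ : ℝ) ^ 2 * (n : ℝ) ^ m := by rw [hpow]; ring
        _ = _ := by rw [← hrate]; ring
    rw [div_le_iff₀ (by positivity)]
    calc (ρ : ℝ) * (k ^ m * Real.log tiltConst)
        ≤ ρ * (k ^ m * |Real.log tiltConst|) := by
          have := le_abs_self (Real.log tiltConst)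
          gcongr
      _ ≤ ρ * ((2 * κ) ^ m * |Real.log tiltConst|) := by gcongr
      _ = 2 ^ m * |Real.log tiltConst| * (ρ * κ ^ m) := by rw [mul_pow]; ring
      _ ≤ 2 ^ m * |Real.log tiltConst| * (R * (n : ℝ) ^ m) := by gcongr
      _ = _ := by ring
  -- The cost of the exceptional event is absorbed by the second term of the rate because `ρ n ≥ 1`.
  have t5 : 1 / (n : ℝ) ^ m ≤ R' := by
    have h1 : 1 ≤ (ρ : ℝ) * n * Real.log n := one_le_mul_of_one_le_of_one_le hρn hlog1
    calc 1 / (n : ℝ) ^ m ≤ (ρ : ℝ) * n * Real.log n / (n : ℝ) ^ m := by gcongr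
      _ = R' := by rw [hR', hnm]; field_simp
  have s1 : 2 * (ρ : ℝ) ^ 2 * (49 * L ^ 2 / (k : ℝ) ^ 2 + k * Real.exp (-((n : ℝ) / k)))
      ≤ (98 * L ^ 2 + 2 * F) * R := by
    calc _ ≤ 2 * (ρ : ℝ) ^ 2 * (49 * L ^ 2 / (k : ℝ) ^ 2 + F / (k : ℝ) ^ 2) := by gcongr
      _ = (98 * L ^ 2 + 2 * F) * ((ρ : ℝ) ^ 2 / (k : ℝ) ^ 2) := by ring
      _ ≤ _ := by gcongr
  have s2 : (160 * (ρ : ℝ) * (n * Real.log k) + 128 * ρ * (k ^ m * Real.log tiltConst)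
        + 8 * Real.exp m) / (n : ℝ) ^ m ≤
      160 * R' + 128 * (2 ^ m * |Real.log tiltConst| * R) + 8 * Real.exp m * R' := by
    calc _ = 160 * ((ρ : ℝ) * (n * Real.log k) / (n : ℝ) ^ m)
          + 128 * ((ρ : ℝ) * (k ^ m * Real.log tiltConst) / (n : ℝ) ^ m)
          + 8 * Real.exp m * (1 / (n : ℝ) ^ m) := by ring
      _ ≤ _ := by gcongr
  rw [riskConst, mul_assoc (m.factorial : ℝ)]
  refine mul_le_mul_of_nonneg_left ((add_le_add s1 s2).trans ?_) (Nat.cast_nonneg _)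
  have e1 : 0 ≤ (98 * L ^ 2 + 2 * F) * R' := by positivity
  have e2 : 0 ≤ 128 * 2 ^ m * |Real.log tiltConst| * R' := by positivity
  have e3 : 0 ≤ (160 + 8 * Real.exp m) * R := by positivity
  linarith

end Hypergraphon

end

/-! ### Assembly over all sample sizes -/

theorem theorem1 (m : ℕ) (hm : 2 ≤ m) (L : ℝ) (hL : 0 < L) :
    ∃ C : ℝ, 0 < C ∧
      ∀ (f₀ : (Fin m → unitInterval) → unitInterval) (hf₀ : Hypergraphon.IsSLH L f₀)
        (n : ℕ) (_ : 1 ≤ n) (ρ : unitInterval) (_ : 0 < (ρ : ℝ))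
        (_ : (Real.log n) ^ 2 * (n : ℝ) ^ (-(2 / ((m : ℝ) + 1))) ≤ (ρ : ℝ))
        (k n₀ : ℕ) (_ : k = ⌈((ρ : ℝ) * (n : ℝ) ^ m) ^ (1 / ((m : ℝ) + 2))⌉₊)
        (_ : n₀ = ⌊(n : ℝ) / (k : ℝ)⌋₊)
        (zhat : Hypergraphon.Hypergraph m n → Fin n → Fin k)
        (Qhat : Hypergraphon.Hypergraph m n → Hypergraphon.Tensor m k)
        (_ : ∀ G, Hypergraphon.IsLeastSquares n₀ (Hypergraphon.adjacency G) (zhat G) (Qhat G)),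
        MeasureTheory.Integrable
          (fun p : (Fin n → unitInterval) × Hypergraphon.Hypergraph m n =>
            (1 / (n : ℝ) ^ m) * Hypergraphon.frobeniusSq
              (Hypergraphon.blockModel (zhat p.2) (Qhat p.2) -
                Hypergraphon.trueTensor ρ f₀ p.1))
          (Hypergraphon.sampleLaw n ρ f₀ hf₀.measurable) ∧
        ∫ p, (1 / (n : ℝ) ^ m) * Hypergraphon.frobeniusSq
              (Hypergraphon.blockModel (zhat p.2) (Qhat p.2) -
                Hypergraphon.trueTensor ρ f₀ p.1)
            ∂(Hypergraphon.sampleLaw n ρ f₀ hf₀.measurable) ≤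
          C * ((ρ : ℝ) ^ ((2 * (m : ℝ) + 2) / ((m : ℝ) + 2)) *
                (n : ℝ) ^ (-(2 * (m : ℝ) / ((m : ℝ) + 2))) +
              (ρ : ℝ) * (Real.log n / (n : ℝ) ^ (m - 1))) := by
  open Hypergraphon in
  obtain ⟨N, hN⟩ := exists_large ((4 * (m + 1) : ℝ) ^ (m + 2))
    ((balanceConst m * 4 ^ (m - 1)) ^ 2) (balanceConst m * 4 ^ (m - 1))
  have hlog2 : 0 < Real.log 2 := Real.log_pos (by norm_num)
  have hC2 : 0 ≤ (N : ℝ) ^ m / Real.log 2 ^ 3 := by positivity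
  have hC1 := riskConst_nonneg m L
  refine ⟨riskConst m L + (N : ℝ) ^ m / Real.log 2 ^ 3 + 1, by positivity, ?_⟩
  intro f₀ hf₀ n hn ρ hρ hdens k n₀ hk hn₀ zhat Qhat hls
  have hQ : ∀ G, Qhat G ∈ blockTensors m k := fun G => (hls G).tensor_mem
  refine ⟨integrable_loss hf₀.measurable ρ zhat hQ, ?_⟩
  have hn0 : (0 : ℝ) < n := by exact_mod_cast hn
  have hlog0 : 0 ≤ Real.log n := Real.log_natCast_nonneg n
  set R := (ρ : ℝ) ^ ((2 * (m : ℝ) + 2) / ((m : ℝ) + 2)) *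
        (n : ℝ) ^ (-(2 * (m : ℝ) / ((m : ℝ) + 2))) with hR
  have hR0 : 0 ≤ R := by positivity
  have hR'0 : 0 ≤ (ρ : ℝ) * (Real.log n / (n : ℝ) ^ (m - 1)) := by positivity
  rcases le_or_gt N n with hNn | hNn
  · obtain ⟨h1, h2, h3⟩ := hN n hNn
    rw [Nat.floor_div_natCast, Nat.floor_natCast] at hn₀
    subst hn₀
    refine (integral_loss_le_rate hL.le hf₀ hm hn hρ hdens (by exact_mod_cast h1) h2 h3 hk
      hls).trans ?_
    refine mul_le_mul_of_nonneg_right ?_ (add_nonneg hR0 hR'0)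
    linarith
  rcases hn.eq_or_lt with h1 | h2
  -- For `n = 1` the logarithmic term vanishes and cannot absorb a constant, but as `m ≥ 2` no tuple
  -- is injective and both tensors are zero.
  · have hzero : ∀ p : (Fin n → unitInterval) × Hypergraph m n,
        1 / (n : ℝ) ^ m * frobeniusSq (blockModel (zhat p.2) (Qhat p.2) - trueTensor ρ f₀ p.1)
          = 0 := by
      intro p
      have hinj : ∀ j : Fin m → Fin n, ¬ Function.Injective j := by
        intro j hj
        have := Fintype.card_le_of_injective j hj
        simp only [Fintype.card_fin] at this
        omega
      simp [frobeniusSq, blockModel, trueTensor, hinj]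
    simp_rw [hzero]
    rw [MeasureTheory.integral_zero]
    exact mul_nonneg (by positivity) (add_nonneg hR0 hR'0)
  -- For `2 ≤ n < N` the loss is at most 1, and the density assumption bounds the logarithmic term
  -- below by `(log 2)³ / N ^ m`; this fixes the second summand of the constant.
  · refine (integral_loss_le_one hf₀.measurable ρ zhat hQ).trans ?_
    have hn1 : (1 : ℝ) ≤ n := by exact_mod_cast hn
    have hl : Real.log 2 ≤ Real.log n :=
      Real.log_le_log (by norm_num) (by exact_mod_cast h2)
    have hρ1 : Real.log n ^ 2 * (n : ℝ)⁻¹ ≤ ρ := by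
      refine le_trans ?_ hdens
      gcongr
      rw [← Real.rpow_neg_one]
      apply Real.rpow_le_rpow_of_exponent_le hn1
      have hm' : (2 : ℝ) ≤ m := by exact_mod_cast hm
      rw [neg_le_neg_iff, div_le_one (by positivity)]
      linarith
    have hkey : Real.log 2 ^ 3 / (N : ℝ) ^ m ≤ ρ * (Real.log n / (n : ℝ) ^ (m - 1)) := by
      have hnm : (n : ℝ) ^ m = n * (n : ℝ) ^ (m - 1) := by
        rw [← pow_succ']; congr 1; omega
      calc Real.log 2 ^ 3 / (N : ℝ) ^ m ≤ Real.log n ^ 3 / (n : ℝ) ^ m := by gcongr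
        _ = Real.log n ^ 2 * (n : ℝ)⁻¹ * (Real.log n / (n : ℝ) ^ (m - 1)) := by
          rw [hnm]; field_simp
        _ ≤ _ := by gcongr
    have hNpos : (0 : ℝ) < N := by
      exact_mod_cast (by omega : 0 < N)
    calc (1 : ℝ) = (N : ℝ) ^ m / Real.log 2 ^ 3 * (Real.log 2 ^ 3 / (N : ℝ) ^ m) := by
          field_simp
      _ ≤ (N : ℝ) ^ m / Real.log 2 ^ 3 * (ρ * (Real.log n / (n : ℝ) ^ (m - 1))) := by gcongr
      _ ≤ (riskConst m L + (N : ℝ) ^ m / Real.log 2 ^ 3 + 1) *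
            (R + ρ * (Real.log n / (n : ℝ) ^ (m - 1))) := by
          apply mul_le_mul <;> linarith
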